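/- Let $I$ be a countable set and $U=(U_{ij})_{i,j\in I}$ a real symmetric matrix with $U_{ij}\ge\min\{U_{ik},U_{kj}\}$ for all $i,j,k$. Put $\mathcal W=\{U_{ij}: i,j\in I\}$ and, for $w\in\mathcal W$, $J(w)=\{i: U_{ii}\ge w\}$, with the equivalence relation $i\equiv_w j\Leftrightarrow U_{ij}\ge w$ on $J(w)$; $E^w_i$ is the class of $i$. Assume (H1) if $U_{ik}=U_{jk}$ for all $k\in I$, then $i=j$; (H2) $\mathcal W\subset(0,\infty)$ and $\mathcal W$ has no finite accumulation point, so that $\mathcal W=\{w_0<w_1<\cdots\}$; (H3) $J(w)/\!\equiv_w$ is finite for every $w\in\mathcal W$. The minimal tree extension. Let $\tilde I=\{(E,w): w\in\mathcal W,\ E\in J(w)/\!\equiv_w\}$, and identify $i\in I$ with $(E_i^{U_{ii}},U_{ii})\in\tilde I$. Let $\tilde{\mathcal T}$ be the tree on $\tilde I$ in which $(E,u)$ and $(E',v)$ are joined iff $\{u,v\}=\{w_n,w_{n+1}\}$ for some $n$ and $E\cap E'\ne\emptyset$; its root is $\tilde r=(I,w_0)$, and $\mathrm{geod}(\cdot,\cdot)$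 denotes its geodesics. The matrix $\tilde U$ on $\tilde I$ extending $U$ is given by $\tilde U_{(E,u),(E',v)}=\min\{u,v\}$ if one of $E,E'$ contains the other, and by $U_{kl}$ with any $k\in E$, $l\in E'$ if they are disjoint. Its generator $\tilde Q$ is $$\tilde Q_{ab}=|\tilde U_{aa}-\tilde U_{bb}|^{-1}\text{ if }(a,b)\in\tilde{\mathcal T},\qquad \tilde Q_{aa}=-\sum_{b:(a,b)\in\tilde{\mathcal T}}\tilde Q_{ab}-w_0^{-1}\mathbf 1_{\{a=\tilde r\}},$$ and $\tilde Q_{ab}=0$ otherwise. Let $\tilde X$ be the minimal continuous-time Markov chain on $\tilde I\cup\{\partial_{\tilde r}\}$, with lifetime $\tilde\zeta$, that jumps inside $\tilde I$ at the rates $\tilde Q_{ab}$, jumps from $\tilde r$ to $\partial_{\tilde r}$ at rate $w_0^{-1}$, and is absorbed at $\partial_{\tilde r}$. Put $\tau=\inf\{t>0:\tilde X_t\in I\cup\{\partial_{\tilde r}\}\}\wedge\tilde\zeta$ and assume (H4) $\mathbb P_{\tilde k}(\tilde X_\tau\in I\cup\{\partial_{\tilde r}\})=1$ for every $\tilde k\in\tilde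 I\setminus I$. For $i\in I$ let $\mathcal V(i)=\{j\in I: j\ne i,\ \mathrm{geod}(i,j)\cap I=\{i,j\}\}$ be the set of $U$-neighbours of $i$. Theorem. There is a symmetric matrix $Q:I\times I\to\mathbb R$ with the following properties. It is a $q$-matrix: $Q_{ij}\ge0$ for $i\ne j$, and each row is summable with $\sum_jQ_{ij}\le0$. One has $QU=UQ=-\mathbb I$, the products being absolutely convergent sums. For all $i,j\in I$, $Q_{ij}\ne0$ if and only if $j\in\mathcal V(i)\cup\{i\}$, and $$Q_{ij}=\tilde Q_{ij}+\sum_{\tilde k\in\tilde I\setminus I}\tilde Q_{i\tilde k}\,\mathbb P_{\tilde k}(\tilde X_\tau=j),$$ a sum with finitely many nonzero terms. Moreover, $Q_{ij}=\tilde Q_{ij}$ if $(i,j)\in\tilde{\mathcal T}$, and if $j\in\mathcal V(i)$ and $(i,j)\notin\tilde{\mathcal T}$, then $Q_{ij}=\tilde Q_{i\tilde k}\,\mathbb P_{\tilde k}(\tilde X_\tau=j)$, where $\tilde k$ is the unique neighbour of $i$ in $\tilde{\mathcal T}$ belonging to $\mathrm{geod}(i,j)$, and $\tilde k\in\tilde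 I\setminus I$. -/

import Mathlib

open scoped ENNReal

noncomputable section

/-! ### Continuous-time Markov chains with a given conservative q-matrix -/

namespace MarkovChain

variable {S : Type*}

/-- Unnormalised jump weights out of `x`: the off-diagonal entries `Q x y`, `y ≠ x`. -/
def jumpWeight (Q : S → S → ℝ) (x y : S) : ℝ≥0∞ :=
  open Classical in if y = x then 0 else ENNReal.ofReal (Q x y)

/-- One-step law of the discrete skeleton: `Q x y / ∑_{z ≠ x} Q x z` on `y ≠ x`;
a state with no outgoing rate is absorbing. -/
def jumpPMF (Q : S → S → ℝ) (x : S) : PMF S :=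
  open Classical in
  if h : tsum (jumpWeight Q x) ≠ 0 ∧ tsum (jumpWeight Q x) ≠ ∞ then
    PMF.normalize (jumpWeight Q x) h.1 h.2
  else PMF.pure x

variable [MeasurableSpace S] [DiscreteMeasurableSpace S]

/-- The transition kernel of the discrete skeleton. -/
def jumpKernel (Q : S → S → ℝ) : ProbabilityTheory.Kernel S S where
  toFun x := (jumpPMF Q x).toMeasure
  measurable' := Measurable.of_discrete

instance (Q : S → S → ℝ) : ProbabilityTheory.IsMarkovKernel (jumpKernel Q) :=
  ⟨fun x => PMF.toMeasure.isProbabilityMeasure (jumpPMF Q x)⟩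

/-- Transition at step `n`, as a kernel from the past up to time `n`: it only sees the state at
time `n`. -/
def stepKernel (Q : S → S → ℝ) (n : ℕ) :
    ProbabilityTheory.Kernel ((i : Finset.Iic n) → (fun _ : ℕ => S) i) S :=
  (jumpKernel Q).comap (fun h => h ⟨n, Finset.mem_Iic.2 le_rfl⟩) (measurable_pi_apply _)

instance (Q : S → S → ℝ) (n : ℕ) : ProbabilityTheory.IsMarkovKernel (stepKernel Q n) := by
  unfold stepKernel; infer_instance

/-- Law on `S^ℕ` of the discrete skeleton `(Y_n)` started at `x`. -/
def skeletonLaw (Q : S → S → ℝ) (x : S) : MeasureTheory.Measure (ℕ → S) :=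
  ProbabilityTheory.Kernel.traj (X := fun _ : ℕ => S) (stepKernel Q) 0 (fun _ => x)

instance : MeasureTheory.IsProbabilityMeasure (ProbabilityTheory.expMeasure 1) :=
  ProbabilityTheory.isProbabilityMeasure_expMeasure one_pos

/-- `ℙ_x`: the law of the skeleton started at `x` together with an independent i.i.d. sequence of
exponential variables of parameter `1`. -/
def law (Q : S → S → ℝ) (x : S) : MeasureTheory.Measure ((ℕ → S) × (ℕ → ℝ)) :=
  (skeletonLaw Q x).prod
    (MeasureTheory.Measure.infinitePi fun _ : ℕ => ProbabilityTheory.expMeasure 1)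

end MarkovChain

namespace MarkovChain

variable {S : Type*}

/-- The `n`-th holding time: exponential of parameter `-Q y y` given that the `n`-th visited state
is `y` (infinite when `Q y y = 0`). -/
def holdingTime (Q : S → S → ℝ) (ω : (ℕ → S) × (ℕ → ℝ)) (n : ℕ) : ℝ≥0∞ :=
  ENNReal.ofReal (ω.2 n) / ENNReal.ofReal (-(Q (ω.1 n) (ω.1 n)))

/-- The `n`-th jump time. -/
def jumpTime (Q : S → S → ℝ) (ω : (ℕ → S) × (ℕ → ℝ)) (n : ℕ) : ℝ≥0∞ :=
  ∑ m ∈ Finset.range n, holdingTime Q ω m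

/-- The lifetime `ζ`: the limit of the jump times. -/
def lifetime (Q : S → S → ℝ) (ω : (ℕ → S) × (ℕ → ℝ)) : ℝ≥0∞ := ⨆ n, jumpTime Q ω n

/-- The minimal chain with q-matrix `Q`: `X_t = Y_n` for `J_n ≤ t < J_{n+1}`, and `none` from the
lifetime on (and at `t = ∞`). -/
def path (Q : S → S → ℝ) (ω : (ℕ → S) × (ℕ → ℝ)) (t : ℝ≥0∞) : Option S :=
  open Classical in
  if h : ∃ n, jumpTime Q ω n ≤ t ∧ t < jumpTime Q ω (n + 1) then some (ω.1 h.choose) else none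

/-- `inf {t > 0 : X_t ∈ A} ∧ ζ`. -/
def hittingTime (Q : S → S → ℝ) (A : Set S) (ω : (ℕ → S) × (ℕ → ℝ)) : ℝ≥0∞ :=
  sInf {t | 0 < t ∧ ∃ s ∈ A, path Q ω t = some s} ⊓ lifetime Q ω

end MarkovChain

/-! ### Ultrametric matrices and their minimal tree extension -/

namespace Ultrametric

variable {I : Type*}

/-- Symmetric arrangements satisfying the ultrametric inequality. -/
structure IsUltrametric (U : Matrix I I ℝ) : Prop where
  symm : ∀ i j, U i j = U j i
  ultra : ∀ i j k, min (U i k) (U k j) ≤ U i j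

/-- The set `𝒲` of values of `U`. -/
def values (U : Matrix I I ℝ) : Set ℝ := {x | ∃ i j, U i j = x}

/-- The class `E_i^w = {j : U_{ij} ≥ w}` of `i` under `≡_w`. -/
def cls (U : Matrix I I ℝ) (w : ℝ) (i : I) : Set I := {j | w ≤ U i j}

/-- The set of equivalence classes of `≡_w` on `J(w) = {i : U_{ii} ≥ w}`. -/
def classes (U : Matrix I I ℝ) (w : ℝ) : Set (Set I) := {E | ∃ i, w ≤ U i i ∧ E = cls U w i}

/-- `i ∼ j` (equality of rows) only for `i = j`. -/
def H1 (U : Matrix I I ℝ) : Prop := ∀ i j, (∀ k, U i k = U j k) ↔ i = j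

/-- The values of `U` are strictly positive and have no finite accumulation point. -/
def H2 (U : Matrix I I ℝ) : Prop :=
  (∀ x ∈ values U, 0 < x) ∧ ∀ x : ℝ, ¬ AccPt x (Filter.principal (values U))

/-- There are finitely many classes at each value. -/
def H3 (U : Matrix I I ℝ) : Prop := ∀ w ∈ values U, (classes U w).Finite

/-- The extended set of sites `Ĩ`: the pairs `(E, w)` with `w ∈ 𝒲` and `E ∈ J(w)/≡_w`. -/
@[ext]
structure Site (U : Matrix I I ℝ) where
  carrier : Set I
  val : ℝ
  val_mem : val ∈ values U
  carrier_mem : carrier ∈ classes U val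

variable (U : Matrix I I ℝ)

/-- The immersion `i ↦ (E_i^{U_ii}, U_ii)` of `I` in `Ĩ`. -/
def embed (i : I) : Site U :=
  ⟨cls U (U i i) i, U i i, ⟨i, i, rfl⟩, ⟨i, le_rfl, rfl⟩⟩

variable {U} in
theorem Site.nonempty (a : Site U) : a.carrier.Nonempty := by
  obtain ⟨i, hi, h⟩ := a.carrier_mem
  exact ⟨i, h ▸ hi⟩

/-- The extension `Ũ` of `U` to `Ĩ`. For disjoint classes the value `U k l` does not depend on the
chosen `k ∈ E`, `l ∈ E'`. -/
def treeMatrix (a b : Site U) : ℝ :=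
  open Classical in
  if a.carrier ⊆ b.carrier ∨ b.carrier ⊆ a.carrier then min a.val b.val
  else U a.nonempty.some b.nonempty.some

/-- `u < v` are consecutive values of `U`, i.e. `u = w_n`, `v = w_{n+1}` for some `n`. -/
def Consecutive (u v : ℝ) : Prop :=
  u ∈ values U ∧ v ∈ values U ∧ u < v ∧ ∀ x ∈ values U, ¬ (u < x ∧ x < v)

/-- The tree `𝒯̃` on `Ĩ`. -/
def tree : SimpleGraph (Site U) where
  Adj a b := (Consecutive U a.val b.val ∨ Consecutive U b.val a.val) ∧
    (a.carrier ∩ b.carrier).Nonempty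
  symm := ⟨fun a b h => ⟨h.1.symm, by rw [Set.inter_comm]; exact h.2⟩⟩
  loopless := ⟨fun a h => by rcases h.1 with h | h <;> exact lt_irrefl _ h.2.2.1⟩

/-- `geod(a, b)`: the set of sites on the (unique) path of the tree joining `a` and `b`. -/
def geod (a b : Site U) : Set (Site U) :=
  {c | ∃ p : (tree U).Walk a b, p.IsPath ∧ c ∈ p.support}

/-- The root `r̃` is the site at the smallest value `w_0`. -/
def IsRoot (a : Site U) : Prop := ∀ x ∈ values U, a.val ≤ x

/-- The set `𝒱(i)` of `U`-neighbours of `i`. -/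
def neighbours (i : I) : Set I :=
  {j | j ≠ i ∧ geod U (embed U i) (embed U j) ∩ Set.range (embed U) = {embed U i, embed U j}}

/-- Off-diagonal entries of `Q̃`: for `b = a⁻` or `a = b⁻`, the inverse of the increment of
`w_{|·|} = Ũ_{··}` along the edge. -/
def conductance (a b : Site U) : ℝ :=
  open Classical in
  if (tree U).Adj a b then |treeMatrix U b b - treeMatrix U a a|⁻¹ else 0

/-- The rate from `a` to the cemetery `∂_r̃`: it is `w_0⁻¹` at the root and `0` elsewhere. -/
def killingRate (a : Site U) : ℝ :=
  open Classical in if IsRoot U a then (treeMatrix U a a)⁻¹ else 0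

/-- The generator `Q̃` of the tree matrix `Ũ`. On the diagonal it is
`-((w_{|a|} - w_{|a|-1})⁻¹ + ∑_{b ∈ S_a} (w_{|b|} - w_{|a|})⁻¹)`, with `w_{-1} = 0`. -/
def treeGenerator (a b : Site U) : ℝ :=
  open Classical in
  if a = b then -((∑' c, conductance U a c) + killingRate U a) else conductance U a b

/-- The state space `Ĩ ∪ {∂_r̃}`. -/
inductive State (U : Matrix I I ℝ) where
  | site (a : Site U)
  | cemetery

instance : MeasurableSpace (State U) := ⊤
instance : DiscreteMeasurableSpace (State U) := ⟨fun _ => trivial⟩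

/-- The conservative extension of `Q̃` to `Ĩ ∪ {∂_r̃}`, with `∂_r̃` absorbing. -/
def extendedGenerator : State U → State U → ℝ
  | .site a, .site b => treeGenerator U a b
  | .site a, .cemetery => killingRate U a
  | .cemetery, _ => 0

/-- The subset `I ∪ {∂_r̃}` of the state space. -/
def target : Set (State U) := {s | s = .cemetery ∨ ∃ i, s = .site (embed U i)}

/-- `X̃_τ` with `τ = inf {t > 0 : X̃_t ∈ I ∪ {∂_r̃}} ∧ ζ̃`; it is `none` when `τ = ζ̃`. -/
def stoppedState (ω : (ℕ → State U) × (ℕ → ℝ)) : Option (State U) :=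
  MarkovChain.path (extendedGenerator U) ω
    (MarkovChain.hittingTime (extendedGenerator U) (target U) ω)

/-- `ℙ_a` for the chain `X̃`. -/
def treeLaw (a : Site U) : MeasureTheory.Measure ((ℕ → State U) × (ℕ → ℝ)) :=
  MarkovChain.law (extendedGenerator U) (.site a)

/-- Started outside `I`, the chain is a.s. in `I ∪ {∂_r̃}` at time `τ`. -/
def H4 : Prop :=
  ∀ a : Site U, a ∉ Set.range (embed U) →
    treeLaw U a {ω | ∃ s ∈ target U, stoppedState U ω = some s} = 1

/-- `ℙ_a(X̃_τ = j)`. -/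
def exitProb (a : Site U) (j : I) : ℝ :=
  (treeLaw U a).real {ω | stoppedState U ω = some (.site (embed U j))}

/-- `Q` is a q-matrix: nonnegative off-diagonal entries, summable rows with nonpositive sum. -/
structure IsQMatrix (Q : Matrix I I ℝ) : Prop where
  nonneg : ∀ i j, i ≠ j → 0 ≤ Q i j
  summable : ∀ i, Summable (Q i)
  sum_nonpos : ∀ i, ∑' j, Q i j ≤ 0

end Ultrametric

end

/-! The extended matrix is the Green function of the tree chain: `treeMatrix_green` gives Q̃Ũ = -𝕀.
Across an edge the function Ũ(·,κ) rises by the full difference of levels if κ lies above the edge,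
and is constant otherwise; the conductance is the inverse of that difference. So every edge below κ
carries unit flow, the killing at the root acts as an edge down to level 0, and the flows at a site
balance except at κ.

Fix k in I. The function Ũ(·,k) is bounded, vanishes at the cemetery and is harmonic off I. By (H4),
optional stopping at τ (`tsum_hitProb_mul`) loses no mass and gives Ũ(a,k) = ∑_j h_a(j) U(j,k),
where h_a is the hitting distribution on I. Let Q be the trace of the generator, Q_ij = ∑_a Q̃_ia
h_a(j). Applying row i of Q̃ to the identity yields QU = -𝕀. The sign conditions on Q follow from
h_a ≥ 0 and ∑_j h_a(j) ≤ 1.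

Symmetry comes from algebra rather than reversibility: the triple product QUQᵀ converges absolutely,
and its two orders of summation give -Q and -Qᵀ (`IsQMatrix.symm_of_mul_eq`). Then UQ = -𝕀 by
transposition.

For the support, h_a(j) > 0 exactly when the tree path from a to j meets I only at j. Since the tree
is acyclic, at most one neighbour of i contributes to Q_ij when j ≠ i, namely the one on the
geodesic. All probabilities are computed on the jump skeleton: holding times are almost surely
positive, and they are finite off the target. -/

noncomputable section

namespace Ultrametric

variable {I : Type*} {U : Matrix I I ℝ}

/-! ### Ultrametric classes, sites and the tree matrix -/

theorem IsUltrametric.le_diag (hU : IsUltrametric U) (i j : I) : U i j ≤ U i i := by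
  have := hU.ultra i i j
  rwa [hU.symm j i, min_self] at this

theorem IsUltrametric.cls_eq (hU : IsUltrametric U) {w : ℝ} {i j : I} (h : w ≤ U i j) :
    cls U w i = cls U w j := by
  ext k
  have h' : w ≤ U j i := hU.symm i j ▸ h
  exact ⟨fun hk => (le_min h' hk).trans (hU.ultra j k i),
    fun hk => (le_min h hk).trans (hU.ultra i k j)⟩

theorem Site.carrier_eq (hU : IsUltrametric U) (a : Site U) {k : I} (hk : k ∈ a.carrier) :
    a.carrier = cls U a.val k := by
  obtain ⟨i, _, h⟩ := a.carrier_mem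
  rw [h] at hk ⊢
  exact hU.cls_eq hk

theorem Site.mem_carrier_iff (hU : IsUltrametric U) (a : Site U) {k l : I} (hk : k ∈ a.carrier) :
    l ∈ a.carrier ↔ a.val ≤ U k l := by
  rw [a.carrier_eq hU hk]; rfl

theorem Site.val_le_diag (hU : IsUltrametric U) (a : Site U) {k : I} (hk : k ∈ a.carrier) :
    a.val ≤ U k k := (a.mem_carrier_iff hU hk).1 hk

theorem Site.ext_of_mem (hU : IsUltrametric U) {a b : Site U} (h : a.val = b.val) {k : I}
    (ha : k ∈ a.carrier) (hb : k ∈ b.carrier) : a = b :=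
  Site.ext (by rw [a.carrier_eq hU ha, b.carrier_eq hU hb, h]) h

theorem Site.carrier_subset (hU : IsUltrametric U) {a b : Site U} (h : a.val ≤ b.val) {k : I}
    (ha : k ∈ a.carrier) (hb : k ∈ b.carrier) : b.carrier ⊆ a.carrier := fun _ hl =>
  (a.mem_carrier_iff hU ha).2 (h.trans ((b.mem_carrier_iff hU hb).1 hl))

/-- The site at level `w` containing `i`. -/
def siteAt (w : ℝ) (hw : w ∈ values U) (i : I) (hi : w ≤ U i i) : Site U :=
  ⟨cls U w i, w, hw, i, hi, rfl⟩

theorem mem_embed (i : I) : i ∈ (embed U i).carrier := show U i i ≤ U i i from le_rfl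

/-- Two indices in one class at their common diagonal level have equal rows by the ultrametric
inequality, so (H1) identifies them. -/
theorem embed_injective (hU : IsUltrametric U) (h1 : H1 U) : Function.Injective (embed U) := by
  intro i j h
  have hv : U i i = U j j := congrArg Site.val h
  have hj : j ∈ (embed U i).carrier := h ▸ mem_embed j
  have hij : U i i ≤ U i j := hj
  refine (h1 i j).1 fun k => ?_
  have h3 := hU.ultra i k j
  have h4 := hU.ultra j k i
  have h5 := hU.le_diag i k
  have h6 := hU.le_diag j k
  rw [hU.symm j i] at h4
  apply le_antisymm
  · exact (le_min (h5.trans hij) le_rfl).trans h4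
  · exact (le_min (h6.trans (hv ▸ hij)) le_rfl).trans h3

/-- One formula covers nested and disjoint classes with arbitrary representatives, and replaces the
case distinction and the choices in all later arguments. -/
theorem treeMatrix_eq (hU : IsUltrametric U) (a b : Site U) {k l : I} (hk : k ∈ a.carrier)
    (hl : l ∈ b.carrier) : treeMatrix U a b = min (min a.val b.val) (U k l) := by
  unfold treeMatrix
  split_ifs with h
  · refine (min_eq_left ?_).symm
    rcases h with h | h
    · refine (min_le_right _ _).trans ?_
      exact (b.mem_carrier_iff hU (h hk)).1 hl
    · refine (min_le_left _ _).trans ?_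
      exact (a.mem_carrier_iff hU hk).1 (h hl)
  -- If U k l reached either level, the two classes would share a point and hence be nested.
  · have key : ∀ {k l}, k ∈ a.carrier → l ∈ b.carrier → U k l < min a.val b.val := by
      intro k l hk hl
      refine lt_min (lt_of_not_ge fun h' => h ?_) (lt_of_not_ge fun h' => h ?_)
      · have hla := (a.mem_carrier_iff hU hk).2 h'
        rcases le_total a.val b.val with hv | hv
        · exact Or.inr (Site.carrier_subset hU hv hla hl)
        · exact Or.inl (Site.carrier_subset hU hv hl hla)
      · have hkb := (b.mem_carrier_iff hU hl).2 (hU.symm k l ▸ h')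
        rcases le_total a.val b.val with hv | hv
        · exact Or.inr (Site.carrier_subset hU hv hk hkb)
        · exact Or.inl (Site.carrier_subset hU hv hkb hk)
    rw [min_eq_right (key hk hl).le]
    set k' := a.nonempty.some
    set l' := b.nonempty.some
    have hk' : k' ∈ a.carrier := a.nonempty.some_mem
    have hl' : l' ∈ b.carrier := b.nonempty.some_mem
    -- Values inside each class exceed U k l, so two uses of the ultrametric inequality change the
    -- representatives without lowering the value.
    have main : ∀ {k k' l l'}, k ∈ a.carrier → k' ∈ a.carrier → l ∈ b.carrier → l' ∈ b.carrier →
        U k l ≤ U k' l' := by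
      intro k k' l l' hk hk' hl hl'
      have e1 := (a.mem_carrier_iff hU hk').1 hk
      have e2 := (b.mem_carrier_iff hU hl).1 hl'
      have e3 := lt_min_iff.1 (key hk hl)
      exact (le_min (e3.1.le.trans e1) (le_min le_rfl (e3.2.le.trans e2) |>.trans
        (hU.ultra k l' l))).trans (hU.ultra k' l' k)
    exact le_antisymm (main hk' hk hl' hl) (main hk hk' hl hl')

theorem treeMatrix_self (a : Site U) : treeMatrix U a a = a.val := by
  simp [treeMatrix]

theorem treeMatrix_embed (hU : IsUltrametric U) (i j : I) :
    treeMatrix U (embed U i) (embed U j) = U i j := by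
  rw [treeMatrix_eq hU _ _ (mem_embed i) (mem_embed j)]
  exact min_eq_right (le_min (hU.le_diag i j) (hU.symm i j ▸ hU.le_diag j i))

theorem treeMatrix_mem_values (hU : IsUltrametric U) (a b : Site U) :
    treeMatrix U a b ∈ values U := by
  rw [treeMatrix_eq hU a b a.nonempty.some_mem b.nonempty.some_mem]
  rcases min_choice (min a.val b.val) (U a.nonempty.some b.nonempty.some) with h | h <;> rw [h]
  · rcases min_choice a.val b.val with h | h <;> rw [h]
    exacts [a.val_mem, b.val_mem]
  · exact ⟨_, _, rfl⟩

theorem treeMatrix_le_left (hU : IsUltrametric U) (a b : Site U) : treeMatrix U a b ≤ a.val := by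
  rw [treeMatrix_eq hU a b a.nonempty.some_mem b.nonempty.some_mem]
  exact (min_le_left _ _).trans (min_le_left _ _)

theorem treeMatrix_le_right (hU : IsUltrametric U) (a b : Site U) : treeMatrix U a b ≤ b.val := by
  rw [treeMatrix_eq hU a b a.nonempty.some_mem b.nonempty.some_mem]
  exact (min_le_left _ _).trans (min_le_right _ _)

/-- `a` is an ancestor of `b` (or `b` itself) exactly when `Ũ a b = Ũ a a`. -/
theorem val_le_treeMatrix_iff (hU : IsUltrametric U) (a b : Site U) :
    a.val ≤ treeMatrix U a b ↔ a.val ≤ b.val ∧ b.carrier ⊆ a.carrier := by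
  rw [treeMatrix_eq hU a b a.nonempty.some_mem b.nonempty.some_mem, le_min_iff, le_min_iff,
    ← a.mem_carrier_iff hU a.nonempty.some_mem]
  constructor
  · rintro ⟨⟨_, h⟩, h'⟩
    exact ⟨h, Site.carrier_subset hU h h' b.nonempty.some_mem⟩
  · rintro ⟨h, h'⟩
    exact ⟨⟨le_rfl, h⟩, h' b.nonempty.some_mem⟩

/-! ### Consecutive values and the structure of the tree -/

/-- Positivity confines these values to the compact interval [0, M], where an infinite set would
accumulate. Neighbouring levels are then extrema of finite sets, and no enumeration of the values is
needed. -/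
theorem H2.finite_values_le (h2 : H2 U) (M : ℝ) : (values U ∩ Set.Iic M).Finite := by
  by_contra h
  obtain ⟨x, _, hx⟩ := Set.Infinite.exists_accPt_of_subset_isCompact h
    (isCompact_Icc (a := (0 : ℝ)) (b := M)) (fun x hx => ⟨(h2.1 x hx.1).le, hx.2⟩)
  exact h2.2 x (hx.mono (Filter.principal_mono.2 Set.inter_subset_left))

theorem H2.exists_consecutive_ge (h2 : H2 U) {x y : ℝ} (hx : x ∈ values U) (hy : y ∈ values U)
    (h : x < y) : ∃ z, Consecutive U x z ∧ z ≤ y := by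
  have hf : (values U ∩ Set.Ioc x y).Finite :=
    (h2.finite_values_le y).subset fun z hz => ⟨hz.1, hz.2.2⟩
  obtain ⟨z, hz, hm⟩ := Set.exists_min_image _ id hf ⟨y, hy, h, le_rfl⟩
  refine ⟨z, ⟨hx, hz.1, hz.2.1, fun t ht h' => ?_⟩, hz.2.2⟩
  exact (hm t ⟨ht, h'.1, h'.2.le.trans hz.2.2⟩).not_gt h'.2

theorem H2.exists_consecutive_lt (h2 : H2 U) {x y : ℝ} (hx : x ∈ values U) (hy : y ∈ values U)
    (h : x < y) : ∃ z, Consecutive U z y := by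
  have hf : (values U ∩ Set.Ico x y).Finite :=
    (h2.finite_values_le y).subset fun z hz => ⟨hz.1, hz.2.2.le⟩
  obtain ⟨z, hz, hm⟩ := Set.exists_max_image _ id hf ⟨x, hx, le_rfl, h⟩
  refine ⟨z, hz.1, hy, hz.2.2, fun t ht h' => ?_⟩
  exact (hm t ⟨ht, hz.2.1.trans h'.1.le, h'.2⟩).not_gt h'.1

theorem Consecutive.le_of_lt {x y z : ℝ} (h : Consecutive U x y) (hz : z ∈ values U)
    (hxz : x < z) : y ≤ z := le_of_not_gt fun h' => h.2.2.2 z hz ⟨hxz, h'⟩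

theorem Consecutive.le_of_gt {x y z : ℝ} (h : Consecutive U x y) (hz : z ∈ values U)
    (hzy : z < y) : z ≤ x := le_of_not_gt fun h' => h.2.2.2 z hz ⟨h', hzy⟩

theorem Consecutive.right_unique {x y z : ℝ} (h : Consecutive U x y) (h' : Consecutive U x z) :
    y = z :=
  le_antisymm (h.le_of_lt h'.2.1 h'.2.2.1) (h'.le_of_lt h.2.1 h.2.2.1)

theorem Consecutive.left_unique {x y z : ℝ} (h : Consecutive U x z) (h' : Consecutive U y z) :
    x = y :=
  le_antisymm (h'.le_of_gt h.1 h.2.2.1) (h.le_of_gt h'.1 h'.2.2.1)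

theorem tree_adj_val_ne {a b : Site U} (h : (tree U).Adj a b) : a.val ≠ b.val := by
  rcases h.1 with h | h
  exacts [h.2.2.1.ne, h.2.2.1.ne']

theorem consecutive_of_adj_lt {a b : Site U} (h : (tree U).Adj a b) (hv : a.val < b.val) :
    Consecutive U a.val b.val := by
  rcases h.1 with h | h
  exacts [h, absurd h.2.2.1 hv.not_gt]

theorem carrier_subset_of_adj_lt (hU : IsUltrametric U) {a b : Site U} (h : (tree U).Adj a b)
    (hv : a.val < b.val) : b.carrier ⊆ a.carrier := by
  obtain ⟨k, hk⟩ := h.2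
  exact Site.carrier_subset hU hv.le hk.1 hk.2

/-- Classes grow as the level drops, so a lower neighbour is the class of any point of a at the
preceding level. -/
theorem parent_unique (hU : IsUltrametric U) {a b c : Site U} (hb : (tree U).Adj a b)
    (hc : (tree U).Adj a c) (hbv : b.val < a.val) (hcv : c.val < a.val) : b = c := by
  obtain ⟨k, hk⟩ := a.nonempty
  exact Site.ext_of_mem hU ((consecutive_of_adj_lt hb.symm hbv).left_unique
    (consecutive_of_adj_lt hc.symm hcv)) (carrier_subset_of_adj_lt hU hb.symm hbv hk)
    (carrier_subset_of_adj_lt hU hc.symm hcv hk)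

theorem exists_parent (hU : IsUltrametric U) (h2 : H2 U) {a : Site U} (ha : ¬ IsRoot U a) :
    ∃ b, (tree U).Adj a b ∧ b.val < a.val := by
  simp only [IsRoot, not_forall, not_le] at ha
  obtain ⟨x, hx, hxa⟩ := ha
  obtain ⟨z, hz⟩ := h2.exists_consecutive_lt hx a.val_mem hxa
  obtain ⟨k, hk⟩ := a.nonempty
  have hkk : z ≤ U k k := hz.2.2.1.le.trans (a.val_le_diag hU hk)
  exact ⟨siteAt z hz.1 k hkk, ⟨Or.inr hz, k, hk, hkk⟩, hz.2.2.1⟩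

theorem exists_child (h2 : H2 U) {a : Site U} {k : I} (hk : k ∈ a.carrier)
    {v : ℝ} (hv : v ∈ values U) (hav : a.val < v) (hvk : v ≤ U k k) :
    ∃ b, (tree U).Adj a b ∧ a.val < b.val ∧ b.val ≤ v ∧ k ∈ b.carrier := by
  obtain ⟨z, hz, hzv⟩ := h2.exists_consecutive_ge a.val_mem hv hav
  have hkk : z ≤ U k k := hzv.trans hvk
  exact ⟨siteAt z hz.2.1 k hkk, ⟨Or.inl hz, k, hk, hkk⟩, hz.2.2.1, hzv, hkk⟩

theorem finite_setOf_val_eq (h3 : H3 U) (v : ℝ) : {b : Site U | b.val = v}.Finite := by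
  by_cases hv : v ∈ values U
  · refine Set.Finite.of_finite_image (f := Site.carrier) ((h3 v hv).subset ?_) ?_
    · rintro _ ⟨b, rfl, rfl⟩
      exact b.carrier_mem
    · intro b hb c hc h
      exact Site.ext h (hb.trans hc.symm)
  · convert Set.finite_empty
    ext b
    simp only [Set.mem_ofPred_eq, Set.mem_empty_iff_false, iff_false]
    rintro rfl
    exact hv b.val_mem

/-- Neighbours occupy at most two levels, each finite by (H3). -/
theorem finite_neighborSet (h3 : H3 U) (a : Site U) : {b | (tree U).Adj a b}.Finite := by
  have aux : ∀ s : Set (Site U), (∀ b ∈ s, ∀ c ∈ s, b.val = c.val) → s.Finite := by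
    intro s hs
    rcases s.eq_empty_or_nonempty with rfl | ⟨b, hb⟩
    · exact Set.finite_empty
    · exact (finite_setOf_val_eq h3 b.val).subset fun c hc => hs c hc b hb
  refine ((aux {b | Consecutive U a.val b.val} fun b hb c hc => hb.right_unique hc).union
    (aux {b | Consecutive U b.val a.val} fun b hb c hc => hb.left_unique hc)).subset ?_
  exact fun b hb => hb.1

/-- Every edge is a bridge: the sites above a can be left only through the edge from a to its
parent. -/
theorem tree_isAcyclic (hU : IsUltrametric U) : (tree U).IsAcyclic := by
  rw [SimpleGraph.isAcyclic_iff_forall_adj_isBridge]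
  have main : ∀ {a p : Site U}, (tree U).Adj a p → p.val < a.val →
      ¬ ((tree U).deleteEdges {s(a, p)}).Reachable a p := by
    rintro a p hap hv ⟨w⟩
    have key : ∀ {c d : Site U}, ((tree U).deleteEdges {s(a, p)}).Walk c d →
        (a.val ≤ c.val ∧ c.carrier ⊆ a.carrier) → (a.val ≤ d.val ∧ d.carrier ⊆ a.carrier) := by
      intro c d w
      induction w with
      | nil => exact id
      | @cons c c' d h _ ih =>
        intro hc
        apply ih
        rw [SimpleGraph.deleteEdges_adj] at h
        obtain ⟨h, hne⟩ := h
        rcases lt_or_gt_of_ne (tree_adj_val_ne h) with hlt | hlt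
        · exact ⟨hc.1.trans hlt.le, (carrier_subset_of_adj_lt hU h hlt).trans hc.2⟩
        · rcases hc.1.lt_or_eq with hac | hac
          · have hv' := (consecutive_of_adj_lt h.symm hlt).le_of_gt a.val_mem hac
            obtain ⟨k, hk⟩ := c.nonempty
            exact ⟨hv', Site.carrier_subset hU hv' (hc.2 hk)
              (carrier_subset_of_adj_lt hU h.symm hlt hk)⟩
          -- A descending step taken at the level of a starts at a itself, so it uses the deleted
          -- edge.
          · obtain ⟨k, hk⟩ := c.nonempty
            obtain rfl : a = c := Site.ext_of_mem hU hac (hc.2 hk) hk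
            obtain rfl := parent_unique hU hap h hv hlt
            exact absurd rfl hne
    exact (key w ⟨le_rfl, subset_rfl⟩).1.not_gt hv
  intro a b hab
  rw [SimpleGraph.isBridge_iff]
  rcases lt_or_gt_of_ne (tree_adj_val_ne hab) with h | h
  · have := main hab.symm h
    rw [Sym2.eq_swap, SimpleGraph.reachable_comm] at this
    exact this
  · have := main hab h
    exact this

/-! ### Conductances and the generator of the tree -/

/-- The neighbours of a site. -/
def nbrs (h3 : H3 U) (a : Site U) : Finset (Site U) := (finite_neighborSet h3 a).toFinset

@[simp] theorem mem_nbrs (h3 : H3 U) {a b : Site U} : b ∈ nbrs h3 a ↔ (tree U).Adj a b := by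
  simp [nbrs]

theorem conductance_of_adj {a b : Site U} (h : (tree U).Adj a b) :
    conductance U a b = |b.val - a.val|⁻¹ := by
  rw [conductance, if_pos h, treeMatrix_self, treeMatrix_self]

theorem conductance_of_not_adj {a b : Site U} (h : ¬ (tree U).Adj a b) :
    conductance U a b = 0 := if_neg h

theorem conductance_pos {a b : Site U} (h : (tree U).Adj a b) : 0 < conductance U a b := by
  rw [conductance_of_adj h, inv_pos, abs_pos, sub_ne_zero]
  exact (tree_adj_val_ne h).symm

theorem conductance_nonneg (a b : Site U) : 0 ≤ conductance U a b := by
  by_cases h : (tree U).Adj a b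
  exacts [(conductance_pos h).le, (conductance_of_not_adj h).ge]

theorem tsum_conductance (h3 : H3 U) (a : Site U) :
    ∑' c, conductance U a c = ∑ c ∈ nbrs h3 a, conductance U a c :=
  tsum_eq_sum fun _ hb => conductance_of_not_adj fun h => hb ((mem_nbrs h3).2 h)

theorem Site.val_pos (h2 : H2 U) (a : Site U) : 0 < a.val := h2.1 _ a.val_mem

theorem killingRate_of_isRoot {a : Site U} (h : IsRoot U a) : killingRate U a = a.val⁻¹ := by
  rw [killingRate, if_pos h, treeMatrix_self]

theorem killingRate_nonneg (h2 : H2 U) (a : Site U) : 0 ≤ killingRate U a := by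
  unfold killingRate
  split_ifs
  · rw [treeMatrix_self]
    exact (inv_pos.2 (a.val_pos h2)).le
  · exact le_rfl

/-- The total rate out of a site. -/
def exitRate (h3 : H3 U) (a : Site U) : ℝ :=
  ∑ c ∈ nbrs h3 a, conductance U a c + killingRate U a

theorem treeGenerator_self (h3 : H3 U) (a : Site U) : treeGenerator U a a = -exitRate h3 a := by
  rw [treeGenerator, if_pos rfl, tsum_conductance h3, exitRate]

theorem treeGenerator_of_ne {a b : Site U} (h : a ≠ b) :
    treeGenerator U a b = conductance U a b := if_neg h

theorem exitRate_pos (hU : IsUltrametric U) (h2 : H2 U) (h3 : H3 U) (a : Site U) :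
    0 < exitRate h3 a := by
  unfold exitRate
  by_cases ha : IsRoot U a
  · refine add_pos_of_nonneg_of_pos (Finset.sum_nonneg fun c _ => conductance_nonneg a c) ?_
    rw [killingRate_of_isRoot ha]
    exact inv_pos.2 (a.val_pos h2)
  · obtain ⟨b, hb, _⟩ := exists_parent hU h2 ha
    refine add_pos_of_pos_of_nonneg ?_ (killingRate_nonneg h2 a)
    exact (conductance_pos hb).trans_le (Finset.single_le_sum (f := fun c => conductance U a c)
      (fun c _ => conductance_nonneg a c) ((mem_nbrs h3).2 hb))

open Classical in
-- This is the unit flow across an edge. When κ is not above b, the level at which b and κ meet is a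
-- value below b's level, hence at most a's level because the two are consecutive; so both ends have
-- the same potential.
theorem conductance_mul_sub (hU : IsUltrametric U) {a b : Site U} (κ : Site U)
    (h : (tree U).Adj a b) (hv : a.val < b.val) :
    conductance U a b * (treeMatrix U b κ - treeMatrix U a κ) =
      if b.val ≤ treeMatrix U b κ then 1 else 0 := by
  obtain ⟨k, hk⟩ := b.nonempty
  obtain ⟨l, hl⟩ := κ.nonempty
  have hka := carrier_subset_of_adj_lt hU h hv hk
  have hc := consecutive_of_adj_lt h hv
  have h1 := treeMatrix_eq hU b κ hk hl
  have h2 := treeMatrix_eq hU a κ hka hl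
  have hm : min κ.val (U k l) ∈ values U := by
    rcases min_choice κ.val (U k l) with h | h <;> rw [h]
    exacts [κ.val_mem, ⟨_, _, rfl⟩]
  rw [min_assoc] at h1 h2
  rw [conductance_of_adj h, abs_of_pos (sub_pos.2 hv)]
  split_ifs with h'
  · have hb : treeMatrix U b κ = b.val := le_antisymm (treeMatrix_le_left hU _ _) h'
    have hle : b.val ≤ min κ.val (U k l) := min_eq_left_iff.1 (h1 ▸ hb)
    rw [hb, h2, min_eq_left (hv.le.trans hle)]
    exact inv_mul_cancel₀ (sub_pos.2 hv).ne'
  · have hlt : min κ.val (U k l) < b.val := by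
      by_contra hle
      rw [h1, min_eq_left (not_lt.1 hle)] at h'
      exact h' le_rfl
    rw [h1, h2, min_eq_right hlt.le, min_eq_right (hc.le_of_gt hm hlt), sub_self, mul_zero]

theorem conductance_symm (a b : Site U) : conductance U a b = conductance U b a := by
  by_cases h : (tree U).Adj a b
  · rw [conductance_of_adj h, conductance_of_adj h.symm, abs_sub_comm]
  · rw [conductance_of_not_adj h, conductance_of_not_adj fun h' => h h'.symm]

open Classical in
-- The children of a supply flow 1 when κ lies strictly above a, and the parent edge removes 1 when
-- κ lies above a or equals a. The difference is the unit mass at κ.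
theorem treeMatrix_green (hU : IsUltrametric U) (h2 : H2 U) (h3 : H3 U) (a κ : Site U) :
    ∑ b ∈ nbrs h3 a, conductance U a b * treeMatrix U b κ - exitRate h3 a * treeMatrix U a κ =
      if a = κ then -1 else 0 := by
  have e1 : ∑ b ∈ nbrs h3 a, conductance U a b * treeMatrix U b κ -
      exitRate h3 a * treeMatrix U a κ =
      ∑ b ∈ nbrs h3 a, conductance U a b * (treeMatrix U b κ - treeMatrix U a κ) -
        killingRate U a * treeMatrix U a κ := by
    simp only [mul_sub, Finset.sum_sub_distrib, exitRate, add_mul, Finset.sum_mul]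
    ring
  have e2 := Finset.sum_filter_add_sum_filter_not (nbrs h3 a) (fun b => a.val < b.val)
    (fun b => conductance U a b * (treeMatrix U b κ - treeMatrix U a κ))
  have echild : ∑ b ∈ nbrs h3 a with a.val < b.val,
      conductance U a b * (treeMatrix U b κ - treeMatrix U a κ) =
      if a.val ≤ treeMatrix U a κ ∧ a ≠ κ then 1 else 0 := by
    rw [Finset.sum_congr rfl (g := fun b => if b.val ≤ treeMatrix U b κ then (1 : ℝ) else 0)
      fun b hb => conductance_mul_sub hU κ ((mem_nbrs h3).1 (Finset.mem_filter.1 hb).1)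
        (Finset.mem_filter.1 hb).2]
    split_ifs with h
    · rw [val_le_treeMatrix_iff hU] at h
      obtain ⟨⟨hv, hs⟩, hne⟩ := h
      obtain ⟨k, hk⟩ := κ.nonempty
      have hlt : a.val < κ.val := hv.lt_of_ne fun he => hne (Site.ext_of_mem hU he (hs hk) hk)
      obtain ⟨b, hab, hlt', hle, hkb⟩ := exists_child h2 (hs hk) κ.val_mem hlt
        (κ.val_le_diag hU hk)
      rw [Finset.sum_eq_single b]
      · rw [if_pos]
        rw [val_le_treeMatrix_iff hU]
        exact ⟨hle, Site.carrier_subset hU hle hkb hk⟩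
      · intro c hc hcb
        rw [Finset.mem_filter, mem_nbrs] at hc
        rw [if_neg]
        rw [val_le_treeMatrix_iff hU]
        rintro ⟨_, hcs⟩
        exact hcb (Site.ext_of_mem hU ((consecutive_of_adj_lt hc.1 hc.2).right_unique
          (consecutive_of_adj_lt hab hlt')) (hcs hk) hkb)
      · intro hb
        exact absurd (Finset.mem_filter.2 ⟨(mem_nbrs h3).2 hab, hlt'⟩) hb
    · refine Finset.sum_eq_zero fun b hb => if_neg fun hb' => h ?_
      rw [Finset.mem_filter, mem_nbrs] at hb
      rw [val_le_treeMatrix_iff hU] at hb' ⊢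
      refine ⟨⟨hb.2.le.trans hb'.1, hb'.2.trans (carrier_subset_of_adj_lt hU hb.1 hb.2)⟩, ?_⟩
      rintro rfl
      exact hb'.1.not_gt hb.2
  -- The root has no parent; killing at rate 1/w₀ takes the place of an edge to level 0.
  have eparent : ∑ b ∈ nbrs h3 a with ¬ a.val < b.val,
      conductance U a b * (treeMatrix U b κ - treeMatrix U a κ) - killingRate U a * treeMatrix U a κ =
      -(if a.val ≤ treeMatrix U a κ then 1 else 0) := by
    by_cases ha : IsRoot U a
    · rw [Finset.sum_eq_zero, killingRate_of_isRoot ha]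
      · have hle : a.val ≤ treeMatrix U a κ := ha _ (treeMatrix_mem_values hU a κ)
        rw [if_pos hle, le_antisymm (treeMatrix_le_left hU a κ) hle,
          inv_mul_cancel₀ (a.val_pos h2).ne', zero_sub]
      · intro b hb
        rw [Finset.mem_filter, mem_nbrs] at hb
        exact absurd ((ha _ b.val_mem).lt_of_ne (tree_adj_val_ne hb.1)) hb.2
    · obtain ⟨p, hp, hpv⟩ := exists_parent hU h2 ha
      rw [Finset.sum_eq_single p]
      · rw [killingRate, if_neg ha, zero_mul, sub_zero, ← conductance_mul_sub hU κ hp.symm hpv,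
          conductance_symm]
        ring
      · intro b hb hbp
        rw [Finset.mem_filter, mem_nbrs] at hb
        exact absurd (parent_unique hU hb.1 hp
          ((not_lt.1 hb.2).lt_of_ne (tree_adj_val_ne hb.1).symm) hpv) hbp
      · intro h
        exact absurd (Finset.mem_filter.2 ⟨(mem_nbrs h3).2 hp, hpv.not_gt⟩) h
  rw [e1, ← e2, add_sub_assoc, eparent, echild]
  by_cases hκ : a = κ
  · subst hκ
    simp [treeMatrix_self]
  · simp [hκ]

instance [Countable I] : Countable (Site U) := by
  let f : Site U → Set.range (fun p : I × I => U p.1 p.2) ×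
      Set.range (fun p : (I × I) × I => cls U (U p.1.1 p.1.2) p.2) := fun a =>
    ⟨⟨a.val, by obtain ⟨i, j, h⟩ := a.val_mem; exact ⟨(i, j), h⟩⟩, ⟨a.carrier, by
      obtain ⟨i, j, h⟩ := a.val_mem
      obtain ⟨k, _, h'⟩ := a.carrier_mem
      exact ⟨((i, j), k), by rw [h', ← h]⟩⟩⟩
  have := (Set.countable_range fun p : I × I => U p.1 p.2).to_subtype
  have := (Set.countable_range fun p : (I × I) × I => cls U (U p.1.1 p.1.2) p.2).to_subtype
  refine Function.Injective.countable (f := f) fun a b h => ?_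
  simp only [f, Prod.mk.injEq, Subtype.mk.injEq] at h
  exact Site.ext h.2 h.1

end Ultrametric
end

noncomputable section

namespace MarkovChain

open MeasureTheory ProbabilityTheory Filter Topology

/-! ### First visits of a trajectory to a set -/

section FirstVisit

variable {S : Type*}

/-- The trajectories that are in `s` at time `n` and avoid `T` before. -/
def firstVisit (T : Set S) (n : ℕ) (s : S) : Set (ℕ → S) := {Y | Y n = s ∧ ∀ m < n, Y m ∉ T}

theorem firstVisit_unique {T : Set S} {Y : ℕ → S} {m n : ℕ} {s t : S} (hs : s ∈ T) (ht : t ∈ T)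
    (h : Y ∈ firstVisit T m s) (h' : Y ∈ firstVisit T n t) : m = n ∧ s = t := by
  have hmn : m = n := by
    rcases lt_trichotomy m n with hlt | he | hlt
    · exact absurd (h.1 ▸ hs) (h'.2 m hlt)
    · exact he
    · exact absurd (h'.1 ▸ ht) (h.2 n hlt)
  subst hmn
  exact ⟨rfl, h.1.symm.trans h'.1⟩

end FirstVisit

/-! ### The jump skeleton, taboo probabilities and optional stopping -/

section Skeleton

variable {S : Type*} [MeasurableSpace S] [DiscreteMeasurableSpace S]

instance (Q : S → S → ℝ) (x : S) : IsProbabilityMeasure (skeletonLaw Q x) := by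
  unfold skeletonLaw; infer_instance

theorem ae_skeletonLaw_zero (Q : S → S → ℝ) (x : S) : ∀ᵐ Y ∂skeletonLaw Q x, Y 0 = x := by
  have h := Kernel.traj_map_frestrictLe_apply (X := fun _ : ℕ => S) (κ := stepKernel Q) 0 0
    (fun _ => x)
  rw [Kernel.partialTraj_self, Kernel.id_apply] at h
  have h' : ∀ᵐ Z ∂((skeletonLaw Q x).map (Preorder.frestrictLe 0)),
      Z ⟨0, Finset.mem_Iic.2 le_rfl⟩ = x := by
    rw [skeletonLaw, h, ae_dirac_iff]
    exact (measurable_pi_apply (X := fun _ => S) (⟨0, Finset.mem_Iic.2 le_rfl⟩ : Finset.Iic 0))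
      (MeasurableSet.of_discrete (s := {x}))
  exact ae_of_ae_map (Preorder.measurable_frestrictLe 0).aemeasurable h'

/-- The event A fixes the present state, so the step kernel is constant on A and the
composition-product factorises. -/
theorem skeletonLaw_markov (Q : S → S → ℝ) (x b c : S) (n : ℕ)
    {A : Set ((i : Finset.Iic n) → (fun _ : ℕ => S) i)} (hA : MeasurableSet A)
    (hb : ∀ h ∈ A, h ⟨n, Finset.mem_Iic.2 le_rfl⟩ = b) :
    skeletonLaw Q x {Y | Preorder.frestrictLe n Y ∈ A ∧ Y (n + 1) = c} =
      skeletonLaw Q x {Y | Preorder.frestrictLe n Y ∈ A} * jumpPMF Q b c := by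
  have hc : MeasurableSet ({c} : Set S) := MeasurableSet.of_discrete
  let ν := Kernel.partialTraj (X := fun _ : ℕ => S) (stepKernel Q) 0 n fun _ => x
  have h1 : (ν ⊗ₘ stepKernel Q n) (A ×ˢ {c}) =
      skeletonLaw Q x {Y | Preorder.frestrictLe n Y ∈ A ∧ Y (n + 1) = c} := by
    rw [Kernel.partialTraj_compProd_eq_map_traj (Nat.zero_le n),
      Measure.map_apply (by fun_prop) (hA.prod hc)]
    rfl
  have h2 : ν A = skeletonLaw Q x {Y | Preorder.frestrictLe n Y ∈ A} := by
    exact (congrArg (fun μ => μ A) (Kernel.traj_map_frestrictLe_apply (X := fun _ : ℕ => S)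
      (κ := stepKernel Q) 0 n fun _ => x).symm).trans
      (Measure.map_apply (Preorder.measurable_frestrictLe (X := fun _ : ℕ => S) n) hA)
  have h3 : ∀ h ∈ A, stepKernel Q n h {c} = jumpPMF Q b c := by
    intro h hh
    change (jumpPMF Q (h ⟨n, Finset.mem_Iic.2 le_rfl⟩)).toMeasure {c} = _
    rw [hb h hh, PMF.toMeasure_apply_singleton _ _ hc]
  rw [← h1, ← h2, Measure.compProd_apply_prod hA hc, setLIntegral_congr_fun hA h3,
    setLIntegral_const, mul_comm]

theorem measurableSet_firstVisit (T : Set S) (n : ℕ) (s : S) :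
    MeasurableSet (firstVisit T n s) := by
  have : firstVisit T n s = (fun Y : ℕ → S => Y n) ⁻¹' {s} ∩
      ⋂ m, ⋂ (_ : m < n), (fun Y : ℕ → S => Y m) ⁻¹' Tᶜ := by
    ext Y; simp [firstVisit]
  rw [this]
  exact (measurable_pi_apply n MeasurableSet.of_discrete).inter (MeasurableSet.iInter fun m =>
    MeasurableSet.iInter fun _ => measurable_pi_apply m MeasurableSet.of_discrete)

/-- The probability of being in `s` at time `n` having avoided `T` before. -/
def taboo (Q : S → S → ℝ) (T : Set S) (x : S) (n : ℕ) (s : S) : ℝ≥0∞ :=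
  skeletonLaw Q x (firstVisit T n s)

open Classical in
theorem taboo_zero (Q : S → S → ℝ) (T : Set S) (x s : S) :
    taboo Q T x 0 s = if s = x then 1 else 0 := by
  have h := ae_skeletonLaw_zero Q x
  split_ifs with hs
  · rw [taboo, ← measure_univ (μ := skeletonLaw Q x)]
    refine measure_congr ?_
    filter_upwards [h] with Y hY
    exact propext ⟨fun _ => trivial, fun _ => ⟨hY.trans hs.symm, fun m hm => absurd hm (by simp)⟩⟩
  · refine measure_mono_null (fun Y hY => ?_) (ae_iff.1 h)
    intro (h' : Y 0 = x)
    exact hs (hY.1.symm.trans h')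

theorem taboo_step (Q : S → S → ℝ) (T : Set S) (x b c : S) (n : ℕ) :
    skeletonLaw Q x {Y | Y ∈ firstVisit T n b ∧ Y (n + 1) = c} =
      taboo Q T x n b * jumpPMF Q b c := by
  have h := skeletonLaw_markov Q x b c n (A := {h | h ⟨n, Finset.mem_Iic.2 le_rfl⟩ = b ∧
    ∀ m (hm : m < n), h ⟨m, Finset.mem_Iic.2 hm.le⟩ ∉ T}) ?_ (fun h hh => hh.1)
  · exact h
  · have : {h : (i : Finset.Iic n) → (fun _ : ℕ => S) i | h ⟨n, Finset.mem_Iic.2 le_rfl⟩ = b ∧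
        ∀ m (hm : m < n), h ⟨m, Finset.mem_Iic.2 hm.le⟩ ∉ T} =
        (fun h => h ⟨n, Finset.mem_Iic.2 le_rfl⟩) ⁻¹' {b} ∩
        ⋂ m, ⋂ (hm : m < n), (fun h => h ⟨m, Finset.mem_Iic.2 hm.le⟩) ⁻¹' Tᶜ := by
      ext h; simp
    rw [this]
    exact (measurable_pi_apply _ (MeasurableSet.of_discrete (s := {b}))).inter
      (MeasurableSet.iInter fun m => MeasurableSet.iInter fun _ =>
        measurable_pi_apply _ (MeasurableSet.of_discrete (s := Tᶜ)))

/-- The probability that the first visit to `T` takes place in `s`. -/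
def hitProb (Q : S → S → ℝ) (T : Set S) (x s : S) : ℝ≥0∞ :=
  skeletonLaw Q x {Y | ∃ n, Y ∈ firstVisit T n s}

theorem hitProb_eq_tsum (Q : S → S → ℝ) {T : Set S} (x : S) {s : S} (hs : s ∈ T) :
    hitProb Q T x s = ∑' n, taboo Q T x n s := by
  have : {Y : ℕ → S | ∃ n, Y ∈ firstVisit T n s} = ⋃ n, firstVisit T n s := by
    ext; simp
  rw [hitProb, this, measure_iUnion _ fun n => measurableSet_firstVisit T n s]
  · rfl
  · exact fun m n hmn => Set.disjoint_left.2 fun Y h h' => hmn (firstVisit_unique hs hs h h').1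

variable [Countable S]

open Classical in
theorem taboo_succ (Q : S → S → ℝ) (T : Set S) (x c : S) (n : ℕ) :
    taboo Q T x (n + 1) c = ∑' b, if b ∈ T then 0 else taboo Q T x n b * jumpPMF Q b c := by
  have hset : firstVisit T (n + 1) c =
      ⋃ b, {Y | b ∉ T ∧ Y ∈ firstVisit T n b ∧ Y (n + 1) = c} := by
    ext Y
    simp only [firstVisit, Set.mem_ofPred_eq, Set.mem_iUnion]
    constructor
    · rintro ⟨h, h'⟩
      exact ⟨Y n, h' n n.lt_succ_self, ⟨rfl, fun m hm => h' m (hm.trans n.lt_succ_self)⟩, h⟩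
    · rintro ⟨b, hb, ⟨hY, h'⟩, h⟩
      refine ⟨h, fun m hm => ?_⟩
      rcases Nat.lt_succ_iff_lt_or_eq.1 hm with hm | rfl
      exacts [h' m hm, hY ▸ hb]
  rw [taboo, hset, measure_iUnion]
  · refine tsum_congr fun b => ?_
    split_ifs with hb
    · simp [hb]
    · simp only [hb, not_false_eq_true, true_and]
      exact taboo_step Q T x b c n
  · intro b b' hbb'
    refine Set.disjoint_left.2 fun Y hY hY' => hbb' ?_
    exact hY.2.1.1.symm.trans hY'.2.1.1
  · intro b
    by_cases hb : b ∈ T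
    · simp [hb]
    · simp only [hb, not_false_eq_true, true_and]
      exact (measurableSet_firstVisit T n b).inter
        ((measurable_pi_apply (X := fun _ : ℕ => S) (n + 1))
          (MeasurableSet.of_discrete (s := {c})))

theorem taboo_mul_jumpPMF_le (Q : S → S → ℝ) (T : Set S) (x : S) {b : S} (c : S) (n : ℕ)
    (hb : b ∉ T) : taboo Q T x n b * jumpPMF Q b c ≤ taboo Q T x (n + 1) c := by
  classical
  rw [taboo_succ]
  refine le_trans ?_ (ENNReal.le_tsum b)
  rw [if_neg hb]

theorem tsum_hitProb (Q : S → S → ℝ) (T : Set S) (x : S) :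
    ∑' s : T, hitProb Q T x s = skeletonLaw Q x {Y | ∃ s ∈ T, ∃ n, Y ∈ firstVisit T n s} := by
  have : {Y : ℕ → S | ∃ s ∈ T, ∃ n, Y ∈ firstVisit T n s} =
      ⋃ s : T, {Y | ∃ n, Y ∈ firstVisit T n (s : S)} := by
    ext; simp
  rw [this, measure_iUnion]
  · rfl
  · intro s t hst
    refine Set.disjoint_left.2 ?_
    rintro Y ⟨m, hm⟩ ⟨n, hn⟩
    exact hst (Subtype.ext (firstVisit_unique s.2 t.2 hm hn).2)
  · intro s
    have : {Y : ℕ → S | ∃ n, Y ∈ firstVisit T n (s : S)} = ⋃ n, firstVisit T n (s : S) := by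
      ext; simp
    rw [this]
    exact MeasurableSet.iUnion fun n => measurableSet_firstVisit T n s

/-- The mean of g along the skeleton stopped at T is conserved. The first sum is the part stopped
before time n; the second counts the paths avoiding T before n, including those entering T exactly
at n. -/
theorem stopped_sum (Q : S → S → ℝ) (T : Set S) (x : S) (g : S → ℝ≥0∞)
    (hg : ∀ b ∉ T, ∑' c, jumpPMF Q b c * g c = g b) (n : ℕ) :
    ∑ m ∈ Finset.range n, ∑' s : T, taboo Q T x m s * g s + ∑' b, taboo Q T x n b * g b = g x := by
  classical
  induction n with
  | zero =>
    simp only [Finset.range_zero, Finset.sum_empty, zero_add, taboo_zero]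
    rw [tsum_eq_single x (fun b hb => by simp [hb])]
    simp
  | succ n ih =>
    rw [← ih, Finset.sum_range_succ, add_assoc]
    congr 1
    have h1 : ∑' c, taboo Q T x (n + 1) c * g c =
        ∑' b, if b ∈ T then 0 else taboo Q T x n b * g b := by
      simp only [taboo_succ, ← ENNReal.tsum_mul_right]
      rw [ENNReal.tsum_comm]
      refine tsum_congr fun b => ?_
      split_ifs with hb
      · simp
      · rw [← hg b hb, ← ENNReal.tsum_mul_left]
        exact tsum_congr fun c => mul_assoc _ _ _
    have h2 : ∑' s : T, taboo Q T x n s * g s =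
        ∑' b, if b ∈ T then taboo Q T x n b * g b else 0 := by
      rw [tsum_subtype T fun b => taboo Q T x n b * g b]
      exact tsum_congr fun b => by simp [Set.indicator_apply]
    rw [h1, h2, ← ENNReal.tsum_add]
    exact tsum_congr fun b => by split_ifs <;> simp

/-- Optional stopping for bounded harmonic functions. -/
theorem tsum_hitProb_mul (Q : S → S → ℝ) (T : Set S) (x : S) (g : S → ℝ≥0∞)
    (hg : ∀ b ∉ T, ∑' c, jumpPMF Q b c * g c = g b) {K : ℝ≥0∞} (hK : K ≠ ∞) (hgK : ∀ s, g s ≤ K)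
    (h1 : ∑' s : T, hitProb Q T x s = 1) :
    ∑' s : T, hitProb Q T x s * g s = g x := by
  have key : ∀ f : S → ℝ≥0∞, ∑' s : T, hitProb Q T x s * f s =
      ∑' m, ∑' s : T, taboo Q T x m s * f s := by
    intro f
    rw [ENNReal.tsum_comm]
    exact tsum_congr fun s => by rw [hitProb_eq_tsum Q x s.2, ENNReal.tsum_mul_right]
  have hone := stopped_sum Q T x (fun _ => 1) (fun b _ => by simp [PMF.tsum_coe])
  have hgs := stopped_sum Q T x g hg
  simp only [mul_one] at hone
  have k1 := key fun _ => 1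
  simp only [mul_one, h1] at k1
  have t1 : Tendsto (fun n => ∑ m ∈ Finset.range n, ∑' s : T, taboo Q T x m s) atTop (𝓝 1) :=
    k1 ▸ ENNReal.tendsto_nat_tsum _
  -- With g = 1 the conservation law says that the unstopped mass is one minus the stopped mass,
  -- which tends to one by `h1`.
  have hR : Tendsto (fun n => ∑' b, taboo Q T x n b) atTop (𝓝 0) := by
    have : (fun n => ∑' b, taboo Q T x n b) =
        fun n => 1 - ∑ m ∈ Finset.range n, ∑' s : T, taboo Q T x m s := by
      funext n
      have hne : ∑ m ∈ Finset.range n, ∑' s : T, taboo Q T x m s ≠ ∞ :=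
        ne_top_of_le_ne_top ENNReal.one_ne_top (hone n ▸ le_self_add)
      rw [← hone n, ENNReal.add_sub_cancel_left hne]
    rw [this]
    simpa using ENNReal.Tendsto.sub (tendsto_const_nhds (x := (1 : ℝ≥0∞))) t1
      (Or.inl ENNReal.one_ne_top)
  have hR' : Tendsto (fun n => ∑' b, taboo Q T x n b * g b) atTop (𝓝 0) := by
    refine tendsto_of_tendsto_of_tendsto_of_le_of_le tendsto_const_nhds
      (h := fun n => (∑' b, taboo Q T x n b) * K) ?_ (fun n => zero_le) fun n => ?_
    · simpa using ENNReal.Tendsto.mul_const hR (Or.inr hK)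
    · dsimp only
      rw [← ENNReal.tsum_mul_right]
      exact ENNReal.tsum_le_tsum fun b => by gcongr; exact hgK b
  have t2 : Tendsto (fun n => ∑ m ∈ Finset.range n, ∑' s : T, taboo Q T x m s * g s) atTop
      (𝓝 (∑' s : T, hitProb Q T x s * g s)) := key g ▸ ENNReal.tendsto_nat_tsum _
  have t3 := t2.add hR'
  simp only [hgs, add_zero] at t3
  exact (tendsto_nhds_unique t3 tendsto_const_nhds)

end Skeleton

/-! ### From the continuous-time path to the skeleton -/

section Path

variable {S : Type*} (Q : S → S → ℝ)

theorem holdingTime_pos {ω : (ℕ → S) × (ℕ → ℝ)} {n : ℕ} (h : 0 < ω.2 n) :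
    0 < holdingTime Q ω n :=
  ENNReal.div_pos (ENNReal.ofReal_pos.2 h).ne' ENNReal.ofReal_ne_top

theorem holdingTime_ne_top {ω : (ℕ → S) × (ℕ → ℝ)} {n : ℕ} (h : Q (ω.1 n) (ω.1 n) < 0) :
    holdingTime Q ω n ≠ ∞ :=
  ENNReal.div_ne_top ENNReal.ofReal_ne_top (ENNReal.ofReal_pos.2 (neg_pos.2 h)).ne'

theorem jumpTime_succ (ω : (ℕ → S) × (ℕ → ℝ)) (n : ℕ) :
    jumpTime Q ω (n + 1) = jumpTime Q ω n + holdingTime Q ω n := Finset.sum_range_succ _ _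

theorem jumpTime_mono (ω : (ℕ → S) × (ℕ → ℝ)) : Monotone (jumpTime Q ω) :=
  monotone_nat_of_le_succ fun n => by rw [jumpTime_succ]; exact le_self_add

theorem path_eq_some {ω : (ℕ → S) × (ℕ → ℝ)} {t : ℝ≥0∞} {s : S} (h : path Q ω t = some s) :
    ∃ n, jumpTime Q ω n ≤ t ∧ t < jumpTime Q ω (n + 1) ∧ ω.1 n = s := by
  unfold path at h
  split_ifs at h with h'
  exact ⟨_, h'.choose_spec.1, h'.choose_spec.2, Option.some.inj h⟩

theorem path_of_mem {ω : (ℕ → S) × (ℕ → ℝ)} {t : ℝ≥0∞} {n : ℕ} (h1 : jumpTime Q ω n ≤ t)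
    (h2 : t < jumpTime Q ω (n + 1)) : path Q ω t = some (ω.1 n) := by
  have h : ∃ n, jumpTime Q ω n ≤ t ∧ t < jumpTime Q ω (n + 1) := ⟨n, h1, h2⟩
  rw [path, dif_pos h]
  have hs := h.choose_spec
  have : h.choose = n := by
    rcases lt_trichotomy h.choose n with hlt | he | hlt
    · exact absurd ((jumpTime_mono Q ω (Nat.succ_le_of_lt hlt)).trans h1) hs.2.not_ge
    · exact he
    · exact absurd ((jumpTime_mono Q ω (Nat.succ_le_of_lt hlt)).trans hs.1) h2.not_ge
  rw [this]

theorem path_lifetime (ω : (ℕ → S) × (ℕ → ℝ)) : path Q ω (lifetime Q ω) = none := by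
  rw [Option.eq_none_iff_forall_ne_some]
  intro s hs
  obtain ⟨n, _, h, _⟩ := path_eq_some Q hs
  exact h.not_ge (le_iSup (jumpTime Q ω) (n + 1))

/-- States outside A have finite holding times, so the n-th jump time is finite and is the hitting
time. -/
theorem path_hittingTime_of_firstVisit {A : Set S} {ω : (ℕ → S) × (ℕ → ℝ)} (h0 : ω.1 0 ∉ A)
    (hneg : ∀ y ∉ A, Q y y < 0) (hpos : ∀ n, 0 < ω.2 n) {n : ℕ} {s : S} (hs : s ∈ A)
    (hn : ω.1 ∈ firstVisit A n s) : path Q ω (hittingTime Q A ω) = some s := by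
  have hfin : ∀ m ≤ n, jumpTime Q ω m ≠ ∞ := fun m hm =>
    ENNReal.sum_ne_top.2 fun l hl => holdingTime_ne_top Q
      (hneg _ (hn.2 l ((Finset.mem_range.1 hl).trans_le hm)))
  -- The holding time in s may be infinite, as at an absorbing state; only its positivity matters.
  have hlt : jumpTime Q ω n < jumpTime Q ω (n + 1) := by
    rw [jumpTime_succ]
    exact ENNReal.lt_add_right (hfin n le_rfl) (holdingTime_pos Q (hpos n)).ne'
  -- The infimum runs over t > 0, so the visit must not occur at time 0; this is where the start
  -- outside A enters.
  have hn0 : 0 < n := by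
    rcases Nat.eq_zero_or_pos n with rfl | h
    · exact absurd (hn.1 ▸ hs) h0
    · exact h
  have hJ : 0 < jumpTime Q ω n :=
    ((holdingTime_pos Q (hpos 0)).trans_le (by
      rw [Nat.succ_eq_add_one, jumpTime_succ]; exact le_add_self)).trans_le
      (jumpTime_mono Q ω hn0)
  have hpath : path Q ω (jumpTime Q ω n) = some s := hn.1 ▸ path_of_mem Q le_rfl hlt
  have : hittingTime Q A ω = jumpTime Q ω n := by
    refine le_antisymm (inf_le_left.trans (sInf_le ⟨hJ, s, hs, hpath⟩))
      (le_inf (le_sInf ?_) (le_iSup (jumpTime Q ω) n))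
    rintro t ⟨_, s', hs', hp⟩
    obtain ⟨m, hm, _, hms⟩ := path_eq_some Q hp
    refine (jumpTime_mono Q ω (le_of_not_gt fun hmn => ?_)).trans hm
    exact hn.2 m hmn (hms ▸ hs')
  rw [this, hpath]

theorem path_hittingTime_iff {A : Set S} {ω : (ℕ → S) × (ℕ → ℝ)} (h0 : ω.1 0 ∉ A)
    (hneg : ∀ y ∉ A, Q y y < 0) (hpos : ∀ n, 0 < ω.2 n) {s : S} (hs : s ∈ A) :
    path Q ω (hittingTime Q A ω) = some s ↔ ∃ n, ω.1 ∈ firstVisit A n s := by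
  classical
  refine ⟨fun h => ?_, fun ⟨n, hn⟩ => path_hittingTime_of_firstVisit Q h0 hneg hpos hs hn⟩
  by_cases hex : ∃ n, ω.1 n ∈ A
  · have hn : ω.1 ∈ firstVisit A (Nat.find hex) (ω.1 (Nat.find hex)) :=
      ⟨rfl, fun m hm => Nat.find_min hex hm⟩
    have h' := path_hittingTime_of_firstVisit Q h0 hneg hpos (Nat.find_spec hex) hn
    rw [h] at h'
    rw [← Option.some.inj h'] at hn
    exact ⟨_, hn⟩
  -- Without a visit the infimum is ⊤, so the hitting time is the lifetime, at which the path is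
  -- `none`.
  · have hempty : {t | 0 < t ∧ ∃ s ∈ A, path Q ω t = some s} = ∅ := by
      refine Set.eq_empty_of_forall_notMem ?_
      rintro t ⟨_, s', hs', hp⟩
      obtain ⟨n, _, _, hn⟩ := path_eq_some Q hp
      exact hex ⟨n, hn ▸ hs'⟩
    rw [hittingTime, hempty, sInf_empty, top_inf_eq, path_lifetime] at h
    exact absurd h (by simp)

theorem ae_expMeasure_pos : ∀ᵐ t ∂expMeasure 1, 0 < t := by
  have h := cdf_expMeasure_eq one_pos 0
  rw [cdf_eq_real] at h
  simp only [le_refl, if_true, mul_zero, neg_zero, Real.exp_zero, sub_self] at h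
  rw [measureReal_eq_zero_iff] at h
  rw [ae_iff]
  convert h using 2
  ext t; simp

variable [MeasurableSpace S] [DiscreteMeasurableSpace S]

instance (x : S) : IsProbabilityMeasure (law Q x) := by unfold law; infer_instance

theorem ae_law (x : S) : ∀ᵐ ω ∂law Q x, ω.1 0 = x ∧ ∀ n, 0 < ω.2 n := by
  have h1 : ∀ᵐ ω ∂law Q x, ω.1 0 = x :=
    Measure.quasiMeasurePreserving_fst.ae (ae_skeletonLaw_zero Q x)
  have h2 : ∀ᵐ ω ∂law Q x, ∀ n, 0 < ω.2 n := by
    refine Measure.quasiMeasurePreserving_snd.ae (p := fun e : ℕ → ℝ => ∀ n, 0 < e n) ?_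
    rw [ae_all_iff]
    intro n
    exact (measurePreserving_eval_infinitePi (fun _ : ℕ => expMeasure 1) n).quasiMeasurePreserving.ae
      ae_expMeasure_pos
  filter_upwards [h1, h2] with ω a b using ⟨a, b⟩

theorem law_fst_preimage (x : S) {B : Set (ℕ → S)} :
    law Q x {ω | ω.1 ∈ B} = skeletonLaw Q x B := by
  have : {ω : (ℕ → S) × (ℕ → ℝ) | ω.1 ∈ B} = B ×ˢ Set.univ := by ext; simp
  rw [this, law, Measure.prod_prod, measure_univ, mul_one]

theorem law_path_hittingTime {A : Set S} {x : S} (hx : x ∉ A) (hneg : ∀ y ∉ A, Q y y < 0)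
    {s : S} (hs : s ∈ A) :
    law Q x {ω | path Q ω (hittingTime Q A ω) = some s} = hitProb Q A x s := by
  rw [hitProb, ← law_fst_preimage]
  refine measure_congr ?_
  filter_upwards [ae_law Q x] with ω hω
  exact propext (path_hittingTime_iff Q (hω.1 ▸ hx) hneg hω.2 hs)

theorem law_exists_path_hittingTime [Countable S] {A : Set S} {x : S} (hx : x ∉ A)
    (hneg : ∀ y ∉ A, Q y y < 0) :
    law Q x {ω | ∃ s ∈ A, path Q ω (hittingTime Q A ω) = some s} = ∑' s : A, hitProb Q A x s := by
  rw [tsum_hitProb, ← law_fst_preimage]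
  refine measure_congr ?_
  filter_upwards [ae_law Q x] with ω hω
  refine propext (exists_congr fun s => and_congr_right fun hs => ?_)
  exact path_hittingTime_iff Q (hω.1 ▸ hx) hneg hω.2 hs

end Path

end MarkovChain
end

noncomputable section

/-! ### Exit laws of the tree chain -/

namespace Ultrametric

open MarkovChain

variable {I : Type*} {U : Matrix I I ℝ}

/-- The states are the sites and one further point. -/
def stateEquiv (U : Matrix I I ℝ) : Option (Site U) ≃ State U where
  toFun o := o.elim .cemetery .site
  invFun
    | .site a => some a
    | .cemetery => none
  left_inv o := by cases o <;> rfl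
  right_inv s := by cases s <;> rfl

instance [Countable I] : Countable (State U) := (stateEquiv U).symm.injective.countable

theorem tsum_state (f : State U → ℝ≥0∞) : ∑' s, f s = f .cemetery + ∑' a, f (.site a) := by
  classical
  rw [← (stateEquiv U).tsum_eq, ENNReal.tsum_eq_add_tsum_ite none]
  congr 1
  have hinj : Function.Injective (some : Site U → Option (Site U)) := Option.some_injective _
  rw [← hinj.tsum_eq]
  · exact tsum_congr fun a => if_neg (Option.some_ne_none a)
  · rintro (_ | a) h
    · simp at h
    · exact ⟨a, rfl⟩

theorem site_notMem_target {a : Site U} : State.site a ∉ target U ↔ a ∉ Set.range (embed U) := by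
  simp [target, eq_comm]

theorem cemetery_mem_target : State.cemetery ∈ target U := Or.inl rfl

theorem embed_mem_target (j : I) : State.site (embed U j) ∈ target U := Or.inr ⟨j, rfl⟩

theorem exists_site_of_notMem_target {s : State U} (h : s ∉ target U) :
    ∃ a, s = .site a ∧ a ∉ Set.range (embed U) := by
  cases s with
  | site a => exact ⟨a, rfl, site_notMem_target.1 h⟩
  | cemetery => exact absurd cemetery_mem_target h

theorem tsum_target (hU : IsUltrametric U) (h1 : H1 U) (f : State U → ℝ≥0∞) :
    ∑' s : target U, f s = f .cemetery + ∑' j, f (.site (embed U j)) := by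
  rw [tsum_subtype, tsum_state, Set.indicator_of_mem cemetery_mem_target]
  congr 1
  rw [← tsum_range (fun a => f (.site a)) (embed_injective hU h1),
    tsum_subtype (Set.range (embed U)) fun a => f (.site a)]
  refine tsum_congr fun a => ?_
  by_cases ha : a ∈ Set.range (embed U)
  · rw [Set.indicator_of_mem ha, Set.indicator_of_mem]
    exact not_not.1 fun h => site_notMem_target.1 h ha
  · rw [Set.indicator_of_notMem ha, Set.indicator_of_notMem (site_notMem_target.2 ha)]

theorem jumpWeight_site (a b : Site U) :
    jumpWeight (extendedGenerator U) (.site a) (.site b) = ENNReal.ofReal (conductance U a b) := by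
  unfold jumpWeight
  by_cases h : a = b
  · subst h
    simp [conductance_of_not_adj]
  · rw [if_neg (fun h' => h (by injection h' with h'; exact h'.symm))]
    exact congrArg _ (treeGenerator_of_ne h)

theorem jumpWeight_cemetery (a : Site U) :
    jumpWeight (extendedGenerator U) (.site a) .cemetery = ENNReal.ofReal (killingRate U a) := by
  unfold jumpWeight
  rw [if_neg (fun h => by cases h)]
  rfl

theorem tsum_jumpWeight_mul (h3 : H3 U) (a : Site U) (f : State U → ℝ≥0∞) :
    ∑' s, jumpWeight (extendedGenerator U) (.site a) s * f s =
      ENNReal.ofReal (killingRate U a) * f .cemetery +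
        ∑ b ∈ nbrs h3 a, ENNReal.ofReal (conductance U a b) * f (.site b) := by
  rw [tsum_state, jumpWeight_cemetery]
  congr 1
  simp only [jumpWeight_site]
  refine tsum_eq_sum fun b hb => ?_
  rw [conductance_of_not_adj fun h => hb ((mem_nbrs h3).2 h)]
  simp

theorem tsum_jumpWeight (h2 : H2 U) (h3 : H3 U) (a : Site U) :
    ∑' s, jumpWeight (extendedGenerator U) (.site a) s = ENNReal.ofReal (exitRate h3 a) := by
  have := tsum_jumpWeight_mul h3 a fun _ => 1
  simp only [mul_one] at this
  rw [this, exitRate, add_comm, ENNReal.ofReal_add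
    (Finset.sum_nonneg fun c _ => conductance_nonneg a c) (killingRate_nonneg h2 a),
    ENNReal.ofReal_sum_of_nonneg fun c _ => conductance_nonneg a c]

theorem jumpPMF_site (hU : IsUltrametric U) (h2 : H2 U) (h3 : H3 U) (a : Site U) (s : State U) :
    jumpPMF (extendedGenerator U) (.site a) s =
      jumpWeight (extendedGenerator U) (.site a) s * (ENNReal.ofReal (exitRate h3 a))⁻¹ := by
  have ht := tsum_jumpWeight h2 h3 a
  have h : tsum (jumpWeight (extendedGenerator U) (.site a)) ≠ 0 ∧
      tsum (jumpWeight (extendedGenerator U) (.site a)) ≠ ∞ := by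
    rw [ht]
    exact ⟨(ENNReal.ofReal_pos.2 (exitRate_pos hU h2 h3 a)).ne', ENNReal.ofReal_ne_top⟩
  rw [jumpPMF, dif_pos h, PMF.normalize_apply, ht]

theorem jumpPMF_site_ne_zero_iff (hU : IsUltrametric U) (h2 : H2 U) (h3 : H3 U) (a b : Site U) :
    jumpPMF (extendedGenerator U) (.site a) (.site b) ≠ 0 ↔ (tree U).Adj a b := by
  rw [jumpPMF_site hU h2 h3, jumpWeight_site, mul_ne_zero_iff]
  constructor
  · rintro ⟨h, _⟩
    by_contra hab
    rw [conductance_of_not_adj hab] at h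
    simp at h
  · intro h
    exact ⟨(ENNReal.ofReal_pos.2 (conductance_pos h)).ne',
      ENNReal.inv_ne_zero.2 ENNReal.ofReal_ne_top⟩

theorem treeMatrix_pos (hU : IsUltrametric U) (h2 : H2 U) (a b : Site U) : 0 < treeMatrix U a b :=
  h2.1 _ (treeMatrix_mem_values hU a b)

/-- The potential of a site, vanishing at the cemetery. -/
def potential (κ : Site U) : State U → ℝ≥0∞
  | .site a => ENNReal.ofReal (treeMatrix U a κ)
  | .cemetery => 0

/-- This is `treeMatrix_green` off κ, divided by the exit rate; the killing term drops because the
potential is zero at the cemetery. -/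
theorem potential_harmonic (hU : IsUltrametric U) (h2 : H2 U) (h3 : H3 U) {a κ : Site U}
    (ha : a ≠ κ) :
    ∑' s, jumpPMF (extendedGenerator U) (.site a) s * potential κ s = potential κ (.site a) := by
  have hr := exitRate_pos hU h2 h3 a
  simp only [jumpPMF_site hU h2 h3, mul_right_comm _ _ (potential κ _)]
  rw [ENNReal.tsum_mul_right, tsum_jumpWeight_mul h3]
  simp only [potential, mul_zero, zero_add]
  have hg := treeMatrix_green hU h2 h3 a κ
  rw [if_neg ha, sub_eq_zero] at hg
  have : ∑ b ∈ nbrs h3 a, ENNReal.ofReal (conductance U a b) * ENNReal.ofReal (treeMatrix U b κ) =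
      ENNReal.ofReal (exitRate h3 a) * ENNReal.ofReal (treeMatrix U a κ) := by
    rw [← ENNReal.ofReal_mul hr.le, ← hg, ENNReal.ofReal_sum_of_nonneg fun b _ =>
      mul_nonneg (conductance_nonneg a b) (treeMatrix_pos hU h2 b κ).le]
    exact Finset.sum_congr rfl fun b _ => (ENNReal.ofReal_mul (conductance_nonneg a b)).symm
  rw [this, mul_right_comm, ENNReal.mul_inv_cancel (ENNReal.ofReal_pos.2 hr).ne'
    ENNReal.ofReal_ne_top, one_mul]

theorem extendedGenerator_neg (hU : IsUltrametric U) (h2 : H2 U) (h3 : H3 U) :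
    ∀ s ∉ target U, extendedGenerator U s s < 0 := by
  intro s hs
  obtain ⟨a, rfl, _⟩ := exists_site_of_notMem_target hs
  change treeGenerator U a a < 0
  rw [treeGenerator_self h3]
  exact neg_neg_of_pos (exitRate_pos hU h2 h3 a)

/-- The law of the first visit of the skeleton to `I ∪ {∂}`. -/
abbrev exitLaw (a : Site U) (s : State U) : ℝ≥0∞ :=
  hitProb (extendedGenerator U) (target U) (.site a) s

theorem exitProb_eq (hU : IsUltrametric U) (h2 : H2 U) (h3 : H3 U) {a : Site U}
    (ha : a ∉ Set.range (embed U)) (j : I) :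
    exitProb U a j = (exitLaw a (.site (embed U j))).toReal := by
  rw [exitLaw, ← law_path_hittingTime _ (site_notMem_target.2 ha) (extendedGenerator_neg hU h2 h3)
    (embed_mem_target j)]
  rfl

theorem exitLaw_ne_top (a : Site U) (s : State U) : exitLaw a s ≠ ∞ :=
  MeasureTheory.measure_ne_top _ _

theorem tsum_exitLaw [Countable I] (hU : IsUltrametric U) (h2 : H2 U) (h3 : H3 U) (h4 : H4 U)
    {a : Site U} (ha : a ∉ Set.range (embed U)) : ∑' s : target U, exitLaw a s = 1 := by
  rw [← h4 a ha]
  exact (law_exists_path_hittingTime _ (site_notMem_target.2 ha)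
    (extendedGenerator_neg hU h2 h3)).symm

theorem tsum_exitLaw_le [Countable I] (hU : IsUltrametric U) (h1 : H1 U) (h2 : H2 U) (h3 : H3 U)
    (h4 : H4 U) {a : Site U} (ha : a ∉ Set.range (embed U)) :
    ∑' j, exitLaw a (.site (embed U j)) ≤ 1 := by
  rw [← tsum_exitLaw hU h2 h3 h4 ha, tsum_target hU h1 fun s => exitLaw a s]
  exact le_add_self

/-- Optional stopping of the potential of k, which is harmonic off I because k lies in I, and
bounded by the level of k. The cemetery contributes nothing. -/
theorem tsum_exitLaw_mul [Countable I] (hU : IsUltrametric U) (h1 : H1 U) (h2 : H2 U) (h3 : H3 U)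
    (h4 : H4 U) {a : Site U} (ha : a ∉ Set.range (embed U)) (k : I) :
    ∑' j, exitLaw a (.site (embed U j)) * ENNReal.ofReal (U j k) =
      ENNReal.ofReal (treeMatrix U a (embed U k)) := by
  have h := tsum_hitProb_mul (extendedGenerator U) (target U) (.site a) (potential (embed U k))
    (fun s hs => ?_) (K := ENNReal.ofReal (embed U k).val) ENNReal.ofReal_ne_top (fun s => ?_)
    (tsum_exitLaw hU h2 h3 h4 ha)
  · rw [tsum_target hU h1 fun s => exitLaw a s * potential (embed U k) s] at h
    simpa [potential, treeMatrix_embed hU] using h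
  · obtain ⟨b, rfl, hb⟩ := exists_site_of_notMem_target hs
    exact potential_harmonic hU h2 h3 fun h => hb ⟨k, h.symm⟩
  · cases s with
    | site b => exact ENNReal.ofReal_le_ofReal (treeMatrix_le_right hU b _)
    | cemetery => exact zero_le

/-! ### Walks of the skeleton -/

theorem exists_walk_of_taboo_ne_zero [Countable I] (hU : IsUltrametric U) (h2 : H2 U) (h3 : H3 U)
    (a : Site U) (n : ℕ) :
    ∀ c, taboo (extendedGenerator U) (target U) (.site a) n (.site c) ≠ 0 →
      ∃ p : (tree U).Walk a c, ∀ v ∈ p.support, v ∈ Set.range (embed U) → v = c := by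
  classical
  induction n with
  | zero =>
    intro c hc
    rw [taboo_zero] at hc
    split_ifs at hc with h
    · injection h with h
      subst h
      exact ⟨.nil, fun v hv _ => by simpa using hv⟩
    · exact absurd rfl hc
  | succ n ih =>
    intro c hc
    rw [taboo_succ, ne_eq, ENNReal.tsum_eq_zero, not_forall] at hc
    obtain ⟨s, hs⟩ := hc
    split_ifs at hs with hT
    · exact absurd rfl hs
    · obtain ⟨b, rfl, hb⟩ := exists_site_of_notMem_target hT
      obtain ⟨hs1, hs2⟩ := mul_ne_zero_iff.1 hs
      obtain ⟨p, hp⟩ := ih b hs1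
      refine ⟨p.concat ((jumpPMF_site_ne_zero_iff hU h2 h3 b c).1 hs2), fun v hv hvI => ?_⟩
      rw [SimpleGraph.Walk.support_concat, List.mem_append,
        List.mem_singleton] at hv
      rcases hv with hv | hv
      · exact absurd (hp v hv hvI ▸ hvI) hb
      · exact hv

/-- Each edge has positive jump probability, so positive taboo mass propagates along the walk. -/
theorem exists_taboo_ne_zero_of_walk [Countable I] (hU : IsUltrametric U) (h2 : H2 U) (h3 : H3 U)
    (a : Site U) {b c : Site U} (p : (tree U).Walk b c) :
    (∀ v ∈ p.support, v ∈ Set.range (embed U) → v = c) →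
    (∃ n, taboo (extendedGenerator U) (target U) (.site a) n (.site b) ≠ 0) →
      ∃ n, taboo (extendedGenerator U) (target U) (.site a) n (.site c) ≠ 0 := by
  induction p with
  | nil => exact fun _ h => h
  | @cons b b' c hadj p ih =>
    rintro hp ⟨n, hn⟩
    -- A vertex of I on the walk is the endpoint c, so the mass has already arrived.
    by_cases hb : b ∈ Set.range (embed U)
    · have := hp b (by simp) hb
      subst this
      exact ⟨n, hn⟩
    · refine ih (fun v hv => hp v (by simp [hv])) ⟨n + 1, fun h0 => ?_⟩
      have := taboo_mul_jumpPMF_le (extendedGenerator U) (target U) (.site a) (.site b') n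
        (site_notMem_target.2 hb)
      rw [h0, nonpos_iff_eq_zero] at this
      exact mul_ne_zero hn ((jumpPMF_site_ne_zero_iff hU h2 h3 b b').2 hadj) this

theorem exitLaw_ne_zero_iff [Countable I] (hU : IsUltrametric U) (h2 : H2 U) (h3 : H3 U)
    (a : Site U) (j : I) :
    exitLaw a (.site (embed U j)) ≠ 0 ↔ ∃ p : (tree U).Walk a (embed U j), p.IsPath ∧
      ∀ v ∈ p.support, v ∈ Set.range (embed U) → v = embed U j := by
  classical
  rw [exitLaw, hitProb_eq_tsum _ _ (embed_mem_target j), ne_eq, ENNReal.tsum_eq_zero, not_forall]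
  constructor
  · rintro ⟨n, hn⟩
    obtain ⟨p, hp⟩ := exists_walk_of_taboo_ne_zero hU h2 h3 a n _ hn
    exact ⟨p.bypass, p.bypass_isPath, fun v hv => hp v (p.support_bypass_subset_support hv)⟩
  · rintro ⟨p, _, hp⟩
    exact exists_taboo_ne_zero_of_walk hU h2 h3 a p hp ⟨0, by simp [taboo_zero]⟩

/-! ### Hitting distributions from all sites -/

/-- The distribution on `I` of the first site of `I` met at a time `≥ 0`, starting from `a`. -/
def hitting (U : Matrix I I ℝ) (a : Site U) (j : I) : ℝ :=
  open Classical in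
  if a ∈ Set.range (embed U) then (if a = embed U j then 1 else 0) else exitProb U a j

theorem hitting_of_notMem {a : Site U} (ha : a ∉ Set.range (embed U)) (j : I) :
    hitting U a j = exitProb U a j := if_neg ha

open Classical in
theorem hitting_embed (hU : IsUltrametric U) (h1 : H1 U) (i j : I) :
    hitting U (embed U i) j = if j = i then 1 else 0 := by
  rw [hitting, if_pos ⟨i, rfl⟩]
  simp only [(embed_injective hU h1).eq_iff, eq_comm]

theorem hitting_nonneg (a : Site U) (j : I) : 0 ≤ hitting U a j := by
  unfold hitting exitProb
  split_ifs <;> positivity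

/-- The kernel h recovers Ũ from U on Ĩ × I: by optional stopping off I, and trivially on I, where
h_a is a Dirac mass. -/
theorem hasSum_hitting_mul [Countable I] (hU : IsUltrametric U) (h1 : H1 U) (h2 : H2 U)
    (h3 : H3 U) (h4 : H4 U) (a : Site U) (k : I) :
    HasSum (fun j => hitting U a j * U j k) (treeMatrix U a (embed U k)) := by
  classical
  by_cases ha : a ∈ Set.range (embed U)
  · obtain ⟨i, rfl⟩ := ha
    simp only [hitting_embed hU h1, treeMatrix_embed hU]
    refine (hasSum_ite_eq i (U i k)).congr_fun fun j => ?_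
    split_ifs with h <;> simp [h]
  · have h := tsum_exitLaw_mul hU h1 h2 h3 h4 ha k
    have hs := ENNReal.hasSum_toReal (h ▸ ENNReal.ofReal_ne_top)
    rw [← ENNReal.tsum_toReal_eq fun j => ENNReal.mul_ne_top (exitLaw_ne_top _ _)
      ENNReal.ofReal_ne_top, h, ENNReal.toReal_ofReal (treeMatrix_pos hU h2 _ _).le] at hs
    convert! hs using 2 with j
    rw [hitting_of_notMem ha, exitProb_eq hU h2 h3 ha, ENNReal.toReal_mul,
      ENNReal.toReal_ofReal (h2.1 _ ⟨j, k, rfl⟩).le]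

theorem exists_hasSum_hitting [Countable I] (hU : IsUltrametric U) (h1 : H1 U) (h2 : H2 U)
    (h3 : H3 U) (h4 : H4 U) (a : Site U) : ∃ r ≤ 1, HasSum (fun j => hitting U a j) r := by
  classical
  by_cases ha : a ∈ Set.range (embed U)
  · obtain ⟨i, rfl⟩ := ha
    refine ⟨1, le_rfl, ?_⟩
    simp only [hitting_embed hU h1]
    exact hasSum_ite_eq i 1
  · have h := tsum_exitLaw_le hU h1 h2 h3 h4 ha
    have hs := ENNReal.hasSum_toReal (ne_top_of_le_ne_top ENNReal.one_ne_top h)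
    rw [← ENNReal.tsum_toReal_eq fun j => exitLaw_ne_top _ _] at hs
    refine ⟨_, ENNReal.toReal_le_of_le_ofReal zero_le_one (by simpa using h), ?_⟩
    convert! hs using 2 with j
    rw [hitting_of_notMem ha, exitProb_eq hU h2 h3 ha]

theorem hitting_ne_zero_iff [Countable I] (hU : IsUltrametric U) (h2 : H2 U) (h3 : H3 U)
    (a : Site U) (j : I) :
    hitting U a j ≠ 0 ↔ ∃ p : (tree U).Walk a (embed U j), p.IsPath ∧
      ∀ v ∈ p.support, v ∈ Set.range (embed U) → v = embed U j := by
  by_cases ha : a ∈ Set.range (embed U)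
  · rw [hitting, if_pos ha]
    constructor
    · intro h
      have h' : a = embed U j := by
        by_contra hne
        rw [if_neg hne] at h
        exact h rfl
      subst h'
      exact ⟨.nil, .nil, fun v hv _ => by simpa using hv⟩
    · rintro ⟨p, _, hp⟩
      rw [if_pos (hp a p.start_mem_support ha)]
      exact one_ne_zero
  · rw [hitting_of_notMem ha, exitProb_eq hU h2 h3 ha, ENNReal.toReal_ne_zero,
      ← exitLaw_ne_zero_iff hU h2 h3]
    exact and_iff_left (exitLaw_ne_top _ _)

theorem cons_isPath_of_hitting (hU : IsUltrametric U) (h1 : H1 U) {i j : I} (hij : i ≠ j)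
    {a : Site U} (h : (tree U).Adj (embed U i) a) {p : (tree U).Walk a (embed U j)}
    (hp : p.IsPath) (hpI : ∀ v ∈ p.support, v ∈ Set.range (embed U) → v = embed U j) :
    (p.cons h).IsPath :=
  SimpleGraph.Walk.IsPath.cons hp fun hi => hij (embed_injective hU h1 (hpI _ hi ⟨i, rfl⟩))

theorem mem_geod_iff (hU : IsUltrametric U) {a b c : Site U} {p : (tree U).Walk a b}
    (hp : p.IsPath) : c ∈ geod U a b ↔ c ∈ p.support := by
  refine ⟨?_, fun h => ⟨p, hp, h⟩⟩
  rintro ⟨q, hq, hc⟩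
  have := congrArg Subtype.val
    (((tree_isAcyclic hU).subsingleton_path a b).elim ⟨p, hp⟩ ⟨q, hq⟩)
  rw [show p = q from this]
  exact hc

/-- The geodesic from i to j is an edge at i followed by a path witnessing a positive hitting
probability. -/
theorem mem_neighbours_iff [Countable I] (hU : IsUltrametric U) (h1 : H1 U) (h2 : H2 U) (h3 : H3 U)
    {i j : I} (hij : i ≠ j) :
    j ∈ neighbours U i ↔ ∃ a, (tree U).Adj (embed U i) a ∧ hitting U a j ≠ 0 := by
  simp only [hitting_ne_zero_iff hU h2 h3]
  constructor
  · rintro ⟨_, hg⟩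
    have hmem : embed U i ∈ geod U (embed U i) (embed U j) ∩ Set.range (embed U) := by
      rw [hg]; exact Or.inl rfl
    obtain ⟨⟨q, hq, _⟩, _⟩ := hmem
    obtain ⟨a, h, p, rfl⟩ := q.exists_eq_cons_of_ne ((embed_injective hU h1).ne hij)
    rw [SimpleGraph.Walk.cons_isPath_iff] at hq
    refine ⟨a, h, p, hq.1, fun v hv hvI => ?_⟩
    have hv' : v ∈ geod U (embed U i) (embed U j) ∩ Set.range (embed U) :=
      ⟨⟨p.cons h, (SimpleGraph.Walk.cons_isPath_iff _ _).2 hq, by simp [hv]⟩, hvI⟩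
    rw [hg] at hv'
    rcases hv' with rfl | hv'
    exacts [absurd hv hq.2, hv']
  · rintro ⟨a, h, p, hp, hpI⟩
    refine ⟨hij.symm, ?_⟩
    have hc := cons_isPath_of_hitting hU h1 hij h hp hpI
    ext v
    rw [Set.mem_inter_iff, mem_geod_iff hU hc, SimpleGraph.Walk.support_cons, List.mem_cons]
    constructor
    · rintro ⟨rfl | hv, hvI⟩
      exacts [Or.inl rfl, Or.inr (hpI v hv hvI)]
    · rintro (rfl | rfl)
      exacts [⟨Or.inl rfl, i, rfl⟩, ⟨Or.inr p.end_mem_support, j, rfl⟩]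

/-- In an acyclic graph the geodesic leaves i through a single neighbour. -/
theorem eq_of_hitting_ne_zero [Countable I] (hU : IsUltrametric U) (h1 : H1 U) (h2 : H2 U)
    (h3 : H3 U) {i j : I} (hij : i ≠ j) {a b : Site U} (ha : (tree U).Adj (embed U i) a)
    (hb : (tree U).Adj (embed U i) b) (haj : hitting U a j ≠ 0)
    (hbg : b ∈ geod U (embed U i) (embed U j)) : b = a := by
  obtain ⟨p, hp, hpI⟩ := (hitting_ne_zero_iff hU h2 h3 a j).1 haj
  have hc := cons_isPath_of_hitting hU h1 hij ha hp hpI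
  exact ((tree_isAcyclic hU).eq_snd_of_adj_start hc hb ((mem_geod_iff hU hc).1 hbg)).trans
    (by simp)

theorem mem_geod_of_hitting_ne_zero [Countable I] (hU : IsUltrametric U) (h1 : H1 U) (h2 : H2 U)
    (h3 : H3 U) {i j : I} (hij : i ≠ j) {a : Site U} (ha : (tree U).Adj (embed U i) a)
    (haj : hitting U a j ≠ 0) : a ∈ geod U (embed U i) (embed U j) := by
  obtain ⟨p, hp, hpI⟩ := (hitting_ne_zero_iff hU h2 h3 a j).1 haj
  exact ⟨p.cons ha, cons_isPath_of_hitting hU h1 hij ha hp hpI, by simp⟩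

/-! ### The trace of the generator on `I` -/

/-- The generator of the chain watched on `I`. -/
def traceGenerator (h3 : H3 U) : Matrix I I ℝ := fun i j =>
  ∑ a ∈ nbrs h3 (embed U i), conductance U (embed U i) a * hitting U a j -
    exitRate h3 (embed U i) * hitting U (embed U i) j

theorem traceGenerator_of_ne (hU : IsUltrametric U) (h1 : H1 U) (h3 : H3 U) {i j : I}
    (hij : i ≠ j) : traceGenerator h3 i j =
      ∑ a ∈ nbrs h3 (embed U i), conductance U (embed U i) a * hitting U a j := by
  simp [traceGenerator, hitting_embed hU h1, hij.symm]

theorem traceGenerator_nonneg (hU : IsUltrametric U) (h1 : H1 U) (h3 : H3 U) {i j : I}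
    (hij : i ≠ j) : 0 ≤ traceGenerator h3 i j := by
  rw [traceGenerator_of_ne hU h1 h3 hij]
  exact Finset.sum_nonneg fun a _ => mul_nonneg (conductance_nonneg _ _) (hitting_nonneg _ _)

/-- Row i of Q is a finite combination of hitting distributions, so no interchange of limits arises
and the claim reduces to `treeMatrix_green`. -/
theorem hasSum_traceGenerator_mul [Countable I] [DecidableEq I] (hU : IsUltrametric U) (h1 : H1 U)
    (h2 : H2 U) (h3 : H3 U) (h4 : H4 U) (i k : I) :
    HasSum (fun j => traceGenerator h3 i j * U j k) (if i = k then -1 else 0) := by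
  have hs := (hasSum_sum (s := nbrs h3 (embed U i)) fun a _ =>
    (hasSum_hitting_mul hU h1 h2 h3 h4 a k).mul_left (conductance U (embed U i) a)).sub
    ((hasSum_hitting_mul hU h1 h2 h3 h4 (embed U i) k).mul_left (exitRate h3 (embed U i)))
  rw [treeMatrix_green hU h2 h3] at hs
  simp only [(embed_injective hU h1).eq_iff] at hs
  convert! hs using 1
  · funext j
    simp only [traceGenerator, sub_mul, Finset.sum_mul, mul_assoc]

theorem isQMatrix_traceGenerator [Countable I] (hU : IsUltrametric U) (h1 : H1 U)
    (h2 : H2 U) (h3 : H3 U) (h4 : H4 U) : IsQMatrix (traceGenerator h3) := by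
  classical
  choose r hr1 hr using exists_hasSum_hitting hU h1 h2 h3 h4
  have hs : ∀ i, HasSum (traceGenerator h3 i) (∑ a ∈ nbrs h3 (embed U i),
      conductance U (embed U i) a * r a - exitRate h3 (embed U i) * r (embed U i)) := fun i =>
    (hasSum_sum (s := nbrs h3 (embed U i)) fun a _ =>
      (hr a).mul_left (conductance U (embed U i) a)).sub ((hr (embed U i)).mul_left _)
  refine ⟨fun i j => traceGenerator_nonneg hU h1 h3, fun i => (hs i).summable, fun i => ?_⟩
  have hri : r (embed U i) = 1 := by
    refine (hr (embed U i)).unique ?_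
    simp only [hitting_embed hU h1]
    exact hasSum_ite_eq i 1
  rw [(hs i).tsum_eq, hri, mul_one, exitRate, sub_nonpos]
  refine le_add_of_le_of_nonneg (Finset.sum_le_sum fun a _ => ?_) (killingRate_nonneg h2 _)
  exact mul_le_of_le_one_right (conductance_nonneg _ _) (hr1 a)

/-- A q-matrix that is a left inverse of a nonnegative symmetric matrix, up to sign, is
symmetric. -/
theorem IsQMatrix.symm_of_mul_eq [DecidableEq I] {Q : Matrix I I ℝ} (hQ : IsQMatrix Q)
    (hU : ∀ i j, U i j = U j i) (hpos : ∀ i j, 0 ≤ U i j) (hdiag : ∀ i, Q i i ≤ 0)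
    (hQU : ∀ i k, HasSum (fun j => Q i j * U j k) (if i = k then -1 else 0)) (i l : I) :
    Q i l = Q l i := by
  -- Only the diagonal entry of a row can be negative, so |Q| differs from Q by -2 Q l l there, and
  -- |Q|U converges.
  have habs : ∀ l j, HasSum (fun k => |Q l k| * U k j)
      ((if l = j then -1 else 0) + -2 * Q l l * U l j) := by
    intro l j
    refine ((hQU l j).add (hasSum_ite_eq l (-2 * Q l l * U l j))).congr_fun fun k => ?_
    by_cases hk : k = l
    · subst hk
      rw [if_pos rfl, abs_of_nonpos (hdiag k)]
      ring
    · rw [if_neg hk, abs_of_nonneg (hQ.nonneg l k (Ne.symm hk)), add_zero]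
  have hsum : Summable fun p : I × I => Q i p.1 * U p.1 p.2 * Q l p.2 := by
    rw [← summable_abs_iff, summable_prod_of_nonneg fun p => abs_nonneg _]
    have hrow : ∀ j, HasSum (fun k => |Q i j * U j k * Q l k|)
        (|Q i j| * ((if l = j then -1 else 0) + -2 * Q l l * U l j)) := fun j =>
      ((habs l j).mul_left |Q i j|).congr_fun fun k => by
        rw [abs_mul, abs_mul, abs_of_nonneg (hpos j k), hU j k]
        ring
    refine ⟨fun j => (hrow j).summable, ?_⟩
    simp only [fun j => (hrow j).tsum_eq, mul_add]
    refine Summable.add ?_ ?_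
    · refine summable_of_ne_finset_zero (s := {l}) fun j hj => ?_
      rw [if_neg fun h => hj (Finset.mem_singleton.2 h.symm), mul_zero]
    · refine ((habs i l).summable.mul_left (-2 * Q l l)).congr fun j => ?_
      rw [hU l j]
      ring
  -- Summing over k first gives -Q i l; summing over j first gives -Q l i.
  have hcomm := Summable.tsum_comm (f := fun j k => Q i j * U j k * Q l k) hsum
  have e1 : ∀ j, ∑' k, Q i j * U j k * Q l k = Q i j * (if l = j then -1 else 0) := fun j => by
    rw [← (hQU l j).tsum_eq, ← tsum_mul_left]
    exact tsum_congr fun k => by rw [hU j k]; ring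
  have e2 : ∀ k, ∑' j, Q i j * U j k * Q l k = (if i = k then -1 else 0) * Q l k := fun k => by
    rw [← (hQU i k).tsum_eq, tsum_mul_right]
  simp only [e1, e2] at hcomm
  rw [tsum_eq_single i (fun k hk => by simp [hk.symm]),
    tsum_eq_single l (fun k hk => by simp [hk.symm])] at hcomm
  simpa using hcomm.symm

/-- Otherwise every term of (QU)_ii would be nonnegative, while their sum is -1. -/
theorem traceGenerator_diag_neg [Countable I] (hU : IsUltrametric U) (h1 : H1 U)
    (h2 : H2 U) (h3 : H3 U) (h4 : H4 U) (i : I) : traceGenerator h3 i i < 0 := by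
  classical
  have h := hasSum_traceGenerator_mul hU h1 h2 h3 h4 i i
  rw [if_pos rfl] at h
  by_contra hn
  refine absurd (h.nonneg fun j => mul_nonneg ?_ (h2.1 _ ⟨j, i, rfl⟩).le) (by norm_num)
  by_cases hij : i = j
  · subst hij
    exact not_lt.1 hn
  · exact traceGenerator_nonneg hU h1 h3 hij

theorem traceGenerator_ne_zero_iff [Countable I] (hU : IsUltrametric U) (h1 : H1 U)
    (h2 : H2 U) (h3 : H3 U) (h4 : H4 U) (i j : I) :
    traceGenerator h3 i j ≠ 0 ↔ j = i ∨ j ∈ neighbours U i := by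
  by_cases hij : i = j
  · subst hij
    exact iff_of_true (traceGenerator_diag_neg hU h1 h2 h3 h4 i).ne (Or.inl rfl)
  · rw [or_iff_right (Ne.symm hij), mem_neighbours_iff hU h1 h2 h3 hij,
      traceGenerator_of_ne hU h1 h3 hij, ne_eq, Finset.sum_eq_zero_iff_of_nonneg fun a _ =>
        mul_nonneg (conductance_nonneg _ _) (hitting_nonneg _ _)]
    push Not
    simp only [mem_nbrs]
    refine exists_congr fun a => and_congr_right fun ha => ?_
    rw [mul_ne_zero_iff]
    exact and_iff_right (conductance_pos ha).ne'

theorem traceGenerator_eq_single [Countable I] (hU : IsUltrametric U) (h1 : H1 U)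
    (h2 : H2 U) (h3 : H3 U) {i j : I} (hij : i ≠ j) {a : Site U}
    (ha : (tree U).Adj (embed U i) a) (haj : hitting U a j ≠ 0) :
    traceGenerator h3 i j = conductance U (embed U i) a * hitting U a j := by
  rw [traceGenerator_of_ne hU h1 h3 hij]
  refine Finset.sum_eq_single a (fun b hb hba => ?_) fun h => absurd ((mem_nbrs h3).2 ha) h
  by_contra hne
  have hb := (mem_nbrs h3).1 hb
  exact hba (eq_of_hitting_ne_zero hU h1 h2 h3 hij ha hb haj
    (mem_geod_of_hitting_ne_zero hU h1 h2 h3 hij hb (mul_ne_zero_iff.1 hne).2))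

theorem embed_ne_of_notMem {i : I} {k : Site U} (hk : k ∉ Set.range (embed U)) : embed U i ≠ k :=
  fun h => hk ⟨i, h⟩

theorem finite_setOf_treeGenerator_ne_zero (h3 : H3 U) (i : I) :
    {k : Site U | k ∉ Set.range (embed U) ∧ treeGenerator U (embed U i) k ≠ 0}.Finite := by
  refine (finite_neighborSet h3 (embed U i)).subset ?_
  rintro k ⟨hk, hne⟩
  rw [treeGenerator_of_ne (embed_ne_of_notMem hk)] at hne
  by_contra hadj
  exact hne (conductance_of_not_adj hadj)

/-- Among the neighbours of i in I, only j itself has a nonzero hitting weight at j, and it produces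
the off-diagonal term Q̃_ij; the others lie outside I and form the sum. -/
theorem hasSum_treeGenerator_mul_exitProb (hU : IsUltrametric U) (h1 : H1 U) (h3 : H3 U)
    (i j : I) :
    HasSum (fun k : {k : Site U // k ∉ Set.range (embed U)} =>
      treeGenerator U (embed U i) k * exitProb U k j)
      (traceGenerator h3 i j - treeGenerator U (embed U i) (embed U j)) := by
  classical
  have key : HasSum ((Set.range (embed U))ᶜ.indicator fun k =>
      treeGenerator U (embed U i) k * exitProb U k j)
      (∑ k ∈ nbrs h3 (embed U i), (Set.range (embed U))ᶜ.indicator (fun k =>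
        treeGenerator U (embed U i) k * exitProb U k j) k) := by
    refine hasSum_sum_of_ne_finset_zero fun k hk => ?_
    rw [Set.indicator_apply_eq_zero]
    intro hkI
    rw [treeGenerator_of_ne (embed_ne_of_notMem hkI),
      conductance_of_not_adj fun h => hk ((mem_nbrs h3).2 h), zero_mul]
  have e : traceGenerator h3 i j - treeGenerator U (embed U i) (embed U j) =
      ∑ k ∈ nbrs h3 (embed U i), (Set.range (embed U))ᶜ.indicator (fun k =>
        treeGenerator U (embed U i) k * exitProb U k j) k := by
    have e1 : ∑ k ∈ nbrs h3 (embed U i), conductance U (embed U i) k * hitting U k j =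
        ∑ k ∈ nbrs h3 (embed U i), (Set.range (embed U))ᶜ.indicator (fun k =>
          treeGenerator U (embed U i) k * exitProb U k j) k + conductance U (embed U i)
            (embed U j) := by
      have e2 : conductance U (embed U i) (embed U j) = ∑ k ∈ nbrs h3 (embed U i),
          if k = embed U j then conductance U (embed U i) k else 0 := by
        rw [Finset.sum_ite_eq']
        split_ifs with h
        exacts [rfl, conductance_of_not_adj fun h' => h ((mem_nbrs h3).2 h')]
      rw [e2, ← Finset.sum_add_distrib]
      refine Finset.sum_congr rfl fun k _ => ?_
      by_cases hk : k ∈ Set.range (embed U)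
      · rw [Set.indicator_of_notMem (by simpa using hk), hitting, if_pos hk]
        split_ifs <;> simp
      · rw [Set.indicator_of_mem hk, hitting_of_notMem hk,
          treeGenerator_of_ne (embed_ne_of_notMem hk),
          if_neg (embed_ne_of_notMem (i := j) hk).symm, add_zero]
    rw [traceGenerator, e1, hitting_embed hU h1]
    by_cases hij : i = j
    · subst hij
      rw [treeGenerator_self h3, if_pos rfl, conductance_of_not_adj (SimpleGraph.irrefl _)]
      ring
    · rw [treeGenerator_of_ne fun h => hij (embed_injective hU h1 h), if_neg (Ne.symm hij)]
      ring
  rw [e]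
  exact hasSum_subtype_iff_indicator.2 key

end Ultrametric
end

/-! ### The theorem -/

theorem mainTheorem7 {I : Type*} [Countable I] [DecidableEq I] (U : Matrix I I ℝ)
    (hU : Ultrametric.IsUltrametric U)
    (h1 : Ultrametric.H1 U) (h2 : Ultrametric.H2 U) (h3 : Ultrametric.H3 U)
    (h4 : Ultrametric.H4 U) :
    ∃ Q : Matrix I I ℝ,
      Ultrametric.IsQMatrix Q ∧ (∀ i j, Q i j = Q j i) ∧
      -- `QU = -𝕀` and `UQ = -𝕀`, as absolutely convergent sums
      (∀ i k, HasSum (fun j => Q i j * U j k) (if i = k then -1 else 0)) ∧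
      (∀ i k, HasSum (fun j => U i j * Q j k) (if i = k then -1 else 0)) ∧
      -- the support of `Q`
      (∀ i j, Q i j ≠ 0 ↔ j = i ∨ j ∈ Ultrametric.neighbours U i) ∧
      -- `Q_{ij} = Q̃_{ij} + ∑_{k ∈ Ĩ ∖ I} Q̃_{ik} ℙ_k(X̃_τ = j)`; a sum with finitely many terms
      (∀ i j,
        {k : Ultrametric.Site U | k ∉ Set.range (Ultrametric.embed U) ∧
          Ultrametric.treeGenerator U (Ultrametric.embed U i) k ≠ 0}.Finite ∧
        HasSum (fun k : {k : Ultrametric.Site U // k ∉ Set.range (Ultrametric.embed U)} =>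
            Ultrametric.treeGenerator U (Ultrametric.embed U i) k * Ultrametric.exitProb U k j)
          (Q i j - Ultrametric.treeGenerator U (Ultrametric.embed U i) (Ultrametric.embed U j))) ∧
      -- the form of this formula off the diagonal
      (∀ i j, (Ultrametric.tree U).Adj (Ultrametric.embed U i) (Ultrametric.embed U j) →
        Q i j = Ultrametric.treeGenerator U (Ultrametric.embed U i) (Ultrametric.embed U j)) ∧
      (∀ i j, j ∈ Ultrametric.neighbours U i →
        ¬ (Ultrametric.tree U).Adj (Ultrametric.embed U i) (Ultrametric.embed U j) →
        ∃ k : Ultrametric.Site U, k ∉ Set.range (Ultrametric.embed U) ∧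
          (Ultrametric.tree U).Adj (Ultrametric.embed U i) k ∧
          k ∈ Ultrametric.geod U (Ultrametric.embed U i) (Ultrametric.embed U j) ∧
          (∀ k', (Ultrametric.tree U).Adj (Ultrametric.embed U i) k' →
            k' ∈ Ultrametric.geod U (Ultrametric.embed U i) (Ultrametric.embed U j) → k' = k) ∧
          Q i j = Ultrametric.treeGenerator U (Ultrametric.embed U i) k *
            Ultrametric.exitProb U k j) := by
  have hQ := Ultrametric.isQMatrix_traceGenerator hU h1 h2 h3 h4
  have hQU := Ultrametric.hasSum_traceGenerator_mul hU h1 h2 h3 h4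
  have hsymm := hQ.symm_of_mul_eq hU.symm (fun i j => (h2.1 _ ⟨i, j, rfl⟩).le)
    (fun i => (Ultrametric.traceGenerator_diag_neg hU h1 h2 h3 h4 i).le) hQU
  have hinj := Ultrametric.embed_injective hU h1
  refine ⟨Ultrametric.traceGenerator h3, hQ, hsymm, hQU, fun i k => ?_,
    Ultrametric.traceGenerator_ne_zero_iff hU h1 h2 h3 h4, fun i j =>
      ⟨Ultrametric.finite_setOf_treeGenerator_ne_zero h3 i,
        Ultrametric.hasSum_treeGenerator_mul_exitProb hU h1 h3 i j⟩, ?_, ?_⟩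
  -- Symmetry of Q and U turns QU = -𝕀 into UQ = -𝕀.
  · simpa only [eq_comm (a := k), hU.symm _ i, hsymm k, mul_comm] using hQU k i
  · intro i j hadj
    have hij : i ≠ j := by
      rintro rfl
      exact SimpleGraph.irrefl _ hadj
    have hone : Ultrametric.hitting U (Ultrametric.embed U j) j = 1 := by
      rw [Ultrametric.hitting_embed hU h1, if_pos rfl]
    rw [Ultrametric.traceGenerator_eq_single hU h1 h2 h3 hij hadj (hone ▸ one_ne_zero), hone,
      mul_one, Ultrametric.treeGenerator_of_ne (hinj.ne hij)]
  · intro i j hj hadj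
    have hij : i ≠ j := hj.1.symm
    obtain ⟨k, hk, hkj⟩ := (Ultrametric.mem_neighbours_iff hU h1 h2 h3 hij).1 hj
    have hkg := Ultrametric.mem_geod_of_hitting_ne_zero hU h1 h2 h3 hij hk hkj
    -- A point of I on the geodesic is one of its endpoints: k = i contradicts irreflexivity, and k
    -- = j contradicts non-adjacency.
    have hkI : k ∉ Set.range (Ultrametric.embed U) := by
      intro hkI
      have h : k ∈ Ultrametric.geod U (Ultrametric.embed U i) (Ultrametric.embed U j) ∩
        Set.range (Ultrametric.embed U) := ⟨hkg, hkI⟩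
      rw [hj.2] at h
      rcases h with rfl | rfl
      exacts [SimpleGraph.irrefl _ hk, hadj hk]
    refine ⟨k, hkI, hk, hkg, fun k' hk' hk'g =>
      Ultrametric.eq_of_hitting_ne_zero hU h1 h2 h3 hij hk hk' hkj hk'g, ?_⟩
    rw [Ultrametric.traceGenerator_eq_single hU h1 h2 h3 hij hk hkj,
      Ultrametric.hitting_of_notMem hkI,
      Ultrametric.treeGenerator_of_ne (Ultrametric.embed_ne_of_notMem hkI)]
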